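/- Let $\kappa$ be an infinite field, $R=\kappa[x_1,\dots,x_n]$ with the standard grading, and $y=x_j$ one of the variables. For $f\in R$ let $\mathrm{in}_y f$ be the sum of all terms of $f$ with the highest power of $y$, and for an ideal $J$ let $\mathrm{in}_y J=\langle \mathrm{in}_y f\mid f\in J\rangle$. A monomial order $<$ is $y$-compatible if $\mathrm{in}_< f=\mathrm{in}_<(\mathrm{in}_y f)$ for all $f\in R$. Given an ideal $I$ and a Gröbner basis $\{y^{d_i}q_i+r_i\mid 1\le i\le m\}$ of $I$ with respect to a $y$-compatible monomial order, where $\mathrm{in}_y(y^{d_i}q_i+r_i)=y^{d_i}q_i$ and $y$ does not divide any term of $q_i$, put $C_{y,I}=\langle q_1,\dots,q_m\rangle$ and $N_{y,I}=\langle q_i\mid d_i=0\rangle$. When $\mathrm{in}_y I=C_{y,I}\cap(N_{y,I}+\langle y\rangle)$, this is called a geometric vertex decomposition of $I$ with respect to $y$; it is nondegenerate if $\sqrt{C_{y,I}}\ne\sqrt{N_{y,I}}$ and $C_{y,I}\neq\langle 1\rangle$. An ideal $J$ is unmixed if $\dim(R/P)=\dim(R/J)$ for all $P\in\mathrm{Ass}(R/J)$;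 it is saturated if $(J:m^\infty)=J$, where $m=\langle x_1,\dots,x_n\rangle$; it is Cohen–Macaulay if $R/J$ is; and it is $G_0$ if $(R/J)_P$ is Gorenstein for every prime $P$ of $R/J$ of height $0$. For homogeneous, saturated, unmixed ideals $I$ and $C$ with $\mathrm{ht}(I)=\mathrm{ht}(C)$ and $\ell\in\mathbb Z$, one says that $I$ is obtained from $C$ by an elementary $G$-biliaison of height $\ell$ if there are a homogeneous, Cohen–Macaulay, $G_0$ ideal $N\subseteq I\cap C$ with $\mathrm{ht}(N)=\mathrm{ht}(I)-1$ and an isomorphism $I/N\cong[C/N](-\ell)$ of graded $R/N$-modules. **Corollary.** Let $I\subseteq R$ be a homogeneous, saturated, unmixed ideal with a nondegenerate geometric vertex decomposition $\mathrm{in}_y I=C_{y,I}\cap(N_{y,I}+\langle y\rangle)$ with respect to some variable $y=x_j$. Assume that $N_{y,I}$ is Cohen–Macaulay and $G_0$ and that $C_{y,I}$ is unmixed. Then $I$ is obtained from $C_{y,I}$ by an elementary $G$-biliaison of height $1$ (in particular, $C_{y,I}$ is homogeneous and saturated and $\mathrm{ht}(C_{y,I})=\mathrm{ht}(I)$). 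-/

import Mathlib

universe u v

namespace GVD

noncomputable section

open MvPolynomial

/-! ### Cohen–Macaulay, Gorenstein and `G₀` rings -/

section Rings

/-- A Noetherian local ring is Cohen–Macaulay if its maximal ideal contains a regular sequence
whose length is the Krull dimension of the ring. -/
def IsCohenMacaulayLocal (A : Type u) [CommRing A] [IsLocalRing A] : Prop :=
  IsNoetherianRing A ∧
    ∃ rs : List A, RingTheory.Sequence.IsRegular A rs ∧
      (∀ r ∈ rs, r ∈ IsLocalRing.maximalIdeal A) ∧
      (rs.length : WithBot ℕ∞) = ringKrullDim A

/-- A Noetherian local ring is Gorenstein if it has finite injective dimension as a module over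
itself. -/
def IsGorensteinLocal (A : Type u) [CommRing A] [IsLocalRing A] : Prop :=
  IsNoetherianRing A ∧
    ∃ n : ℕ, CategoryTheory.HasInjectiveDimensionLE (ModuleCat.of A A) n

/-- A Noetherian ring is Cohen–Macaulay if all its localizations at primes are. -/
def IsCohenMacaulayRing (A : Type u) [CommRing A] : Prop :=
  IsNoetherianRing A ∧
    ∀ (P : Ideal A) [P.IsPrime], IsCohenMacaulayLocal (Localization.AtPrime P)

/-- A ring is `G₀` if its localization at every prime ideal of height `0` is Gorenstein. -/
def IsGZeroRing (A : Type u) [CommRing A] : Prop :=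
  ∀ (P : Ideal A) [P.IsPrime], P.height = 0 → IsGorensteinLocal (Localization.AtPrime P)

end Rings

/-! ### Ideals of the standard graded polynomial ring `κ[x₁, …, xₙ]` -/

section Ideals

attribute [local instance] MvPolynomial.gradedAlgebra

variable {κ : Type u} [Field κ] {n : ℕ}

/-- `I` is unmixed if `dim (R/P) = dim (R/I)` for every associated prime `P` of `R/I`. -/
def IsUnmixed (I : Ideal (MvPolynomial (Fin n) κ)) : Prop :=
  ∀ P ∈ associatedPrimes (MvPolynomial (Fin n) κ) (MvPolynomial (Fin n) κ ⧸ I),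
    ringKrullDim (MvPolynomial (Fin n) κ ⧸ P) = ringKrullDim (MvPolynomial (Fin n) κ ⧸ I)

/-- `I` is homogeneous for the standard grading. -/
def IsHomogeneousIdeal (I : Ideal (MvPolynomial (Fin n) κ)) : Prop :=
  I.IsHomogeneous (homogeneousSubmodule (Fin n) κ)

variable (κ n) in
/-- The homogeneous maximal ideal `⟨x₁, …, xₙ⟩`. -/
def irrelevantIdeal : Ideal (MvPolynomial (Fin n) κ) :=
  Ideal.span (Set.range X)

/-- `I` is saturated: `I : m^∞ = I` for the homogeneous maximal ideal `m`. -/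
def IsSaturated (I : Ideal (MvPolynomial (Fin n) κ)) : Prop :=
  ∀ (f : MvPolynomial (Fin n) κ) (k : ℕ), (∀ g ∈ irrelevantIdeal κ n ^ k, g * f ∈ I) → f ∈ I

/-- The ideal `I` is Cohen–Macaulay, that is, the ring `R/I` is. -/
def IsCohenMacaulayIdeal (I : Ideal (MvPolynomial (Fin n) κ)) : Prop :=
  IsCohenMacaulayRing (MvPolynomial (Fin n) κ ⧸ I)

/-- The ideal `I` is `G₀`, that is, the ring `R/I` is. -/
def IsGZeroIdeal (I : Ideal (MvPolynomial (Fin n) κ)) : Prop :=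
  IsGZeroRing (MvPolynomial (Fin n) κ ⧸ I)

end Ideals

/-! ### Elementary `G`-biliaison -/

section Biliaison

variable {κ : Type u} [Field κ] {n : ℕ}

/-- For `N ⊆ J`, the ideal `J/N` of `R/N`, which is a module over `R/N`. -/
abbrev quotIdeal (N J : Ideal (MvPolynomial (Fin n) κ)) :
    Ideal (MvPolynomial (Fin n) κ ⧸ N) :=
  J.map (Ideal.Quotient.mk N)

/-- `x` lies in the degree `d` part of the graded module `J/N`, where `d` is an integer (the part
of negative degree is zero). -/
def HasDegree (N J : Ideal (MvPolynomial (Fin n) κ)) (d : ℤ) (x : quotIdeal N J) : Prop :=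
  x = 0 ∨ ∃ f ∈ J, ∃ e : ℕ, (e : ℤ) = d ∧ f.IsHomogeneous e ∧ Ideal.Quotient.mk N f = x.1

/-- There is an isomorphism `I/N ≅ [C/N](-ℓ)` of graded `R/N`-modules, the degree `d` part of
`[C/N](-ℓ)` being the degree `d - ℓ` part of `C/N`. -/
def GradedIso (N I C : Ideal (MvPolynomial (Fin n) κ)) (ℓ : ℤ) : Prop :=
  ∃ φ : quotIdeal N I ≃ₗ[MvPolynomial (Fin n) κ ⧸ N] quotIdeal N C,
    ∀ (d : ℤ) (x : quotIdeal N I), HasDegree N I d x ↔ HasDegree N C (d - ℓ) (φ x)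

/-- `I` is obtained from `C` by an elementary `G`-biliaison of height `ℓ`. -/
structure IsElementaryGBiliaison (I C : Ideal (MvPolynomial (Fin n) κ)) (ℓ : ℤ) : Prop where
  homogeneous_left : IsHomogeneousIdeal I
  saturated_left : IsSaturated I
  unmixed_left : IsUnmixed I
  homogeneous_right : IsHomogeneousIdeal C
  saturated_right : IsSaturated C
  unmixed_right : IsUnmixed C
  height_eq : I.height = C.height
  exists_iso : ∃ N : Ideal (MvPolynomial (Fin n) κ),
    N ≤ I ⊓ C ∧ IsHomogeneousIdeal N ∧ IsCohenMacaulayIdeal N ∧ IsGZeroIdeal N ∧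
      N.height + 1 = I.height ∧ GradedIso N I C ℓ

end Biliaison

/-! ### Geometric vertex decomposition with respect to the variable `y = x_j` -/

section VertexDecomposition

variable {κ : Type u} [Field κ] {n : ℕ}

/-- The initial `y`-form of `f`: the sum of all terms of `f` with the highest power of `y`. -/
def initialForm (j : Fin n) (f : MvPolynomial (Fin n) κ) : MvPolynomial (Fin n) κ :=
  ∑ s ∈ f.support with s j = f.degreeOf j, monomial s (f.coeff s)

/-- The polynomial `q`, not involving `y`, with `in_y f = y ^ d * q`, where `d` is the degree of
`f` in `y`. -/
def initialCoeff (j : Fin n) (f : MvPolynomial (Fin n) κ) : MvPolynomial (Fin n) κ :=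
  ∑ s ∈ f.support with s j = f.degreeOf j, monomial (s.erase j) (f.coeff s)

/-- `in_y J`, the ideal generated by the initial `y`-forms of the elements of `J`. -/
def initialIdeal (j : Fin n) (J : Ideal (MvPolynomial (Fin n) κ)) :
    Ideal (MvPolynomial (Fin n) κ) :=
  Ideal.span (initialForm j '' (J : Set (MvPolynomial (Fin n) κ)))

variable (κ) in
/-- A monomial order is `y`-compatible if `in_< f = in_< (in_y f)` for every `f`. -/
def IsCompatible (j : Fin n) (lt : MonomialOrder.{0, v} (Fin n)) : Prop :=
  ∀ f : MvPolynomial (Fin n) κ, lt.leadingTerm f = lt.leadingTerm (initialForm j f)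

/-- `G` is a Gröbner basis of `I`: it is a finite subset of `I` whose leading terms generate the
ideal of leading terms of `I`. -/
def IsGroebnerBasis (lt : MonomialOrder.{0, v} (Fin n)) (G : Finset (MvPolynomial (Fin n) κ))
    (I : Ideal (MvPolynomial (Fin n) κ)) : Prop :=
  (∀ g ∈ G, g ∈ I) ∧
    Ideal.span (lt.leadingTerm '' (G : Set (MvPolynomial (Fin n) κ))) =
      Ideal.span (lt.leadingTerm '' (I : Set (MvPolynomial (Fin n) κ)))

/-- The ideal `C_{y,I} = ⟨q_i⟩` read off from a Gröbner basis `{y ^ d_i * q_i + r_i}` of `I`. -/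
def cIdeal (j : Fin n) (G : Finset (MvPolynomial (Fin n) κ)) :
    Ideal (MvPolynomial (Fin n) κ) :=
  Ideal.span {q | ∃ g ∈ G, q = initialCoeff j g}

/-- The ideal `N_{y,I} = ⟨q_i | d_i = 0⟩` read off from a Gröbner basis `{y ^ d_i * q_i + r_i}`
of `I`. -/
def nIdeal (j : Fin n) (G : Finset (MvPolynomial (Fin n) κ)) :
    Ideal (MvPolynomial (Fin n) κ) :=
  Ideal.span {q | ∃ g ∈ G, g.degreeOf j = 0 ∧ q = initialCoeff j g}

/-- `in_y I = C_{y,I} ∩ (N_{y,I} + ⟨y⟩)`, where `G` is a Gröbner basis of `I`. -/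
def IsGeometricVertexDecomposition (j : Fin n) (I : Ideal (MvPolynomial (Fin n) κ))
    (G : Finset (MvPolynomial (Fin n) κ)) : Prop :=
  initialIdeal j I = cIdeal j G ⊓ (nIdeal j G ⊔ Ideal.span {X j})

/-- A geometric vertex decomposition is degenerate if `√C_{y,I} = √N_{y,I}` or `C_{y,I} = ⟨1⟩`. -/
def IsDegenerate (j : Fin n) (G : Finset (MvPolynomial (Fin n) κ)) : Prop :=
  (cIdeal j G).radical = (nIdeal j G).radical ∨ cIdeal j G = ⊤

end VertexDecomposition

end

end GVD

/-!
Write `R = κ[x₁, …, xₙ]`, `C = C_{y,I}` and `N = N_{y,I}`.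

**The isomorphism.** Division by a Gröbner basis for a `y`-compatible order never raises the degree
in `y`. Hence `C` is generated by the leading coefficients in `y` of the elements of `I`, and `N` by
the elements of `I` free of `y` (`IsGroebnerBasis.division`). The equality
`in_y I = C ∩ (N + ⟨y⟩)` says that every element of `C` free of `y` is the coefficient `q` of an
element `q y + r` of `I` with `q` and `r` free of `y`; by division by `y`-leading terms, such
elements generate `I`. For two of them, `q (q' y + r') - q' (q y + r)` lies in `I` and is free of
`y`, hence lies in `N`. So the assignment `q y + r ↦ q` is multiplication by a fraction modulo `N`,
and it defines an isomorphism `I/N ≅ [C/N](-1)` as soon as neither `I` nor `C` consists of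
zerodivisors modulo `N`. The properties of `I`, `C` and `N` used here are collected in
`IsLinearExtension`, the graph of the isomorphism is `IsLinked`, and the isomorphism itself is
`IsLinearExtension.gradedIso`.

**Minimal primes of `N`.** Since `R/N` is Cohen–Macaulay, its associated primes are minimal, and
since `N` is homogeneous, these have all the same height (compare chains of primes through them up
to the irrelevant ideal). A minimal prime `P` of `N` which contains `C` contains `I`
(`IsLinearExtension.left_le_of_right_le`), hence is minimal over `I`. A minimal prime `P` of `N`
which does not contain `C` is contained in a minimal prime `Q` of `I` with `ht (Q/P) = 1`, namely
the kernel of `R → Frac (R/P)` sending `y` to `-r/q`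
(`IsLinearExtension.exists_mem_minimalPrimes`). As `I` is unmixed, only one of the two cases occurs.
The first would give `√C = √N`, so the second holds for all `P`. This shows that `I` and `C` contain
nonzerodivisors modulo `N`, and that `ht I = ht N + 1`.

**The height of `C`.** An associated prime `P` of `R/C` with `ht (P/N) ≥ 2` is an associated prime
of `R/I`, because `I/N ≅ C/N` and `R/N` has depth at least two at `P`
(`IsLinearExtension.mem_associatedPrimes`); its height is then `ht I`. The other associated primes
of `R/C` have height `ht N + 1`. In both cases the height is `ht I`, so `ht C = ht I`.

**Saturation.** If `C` were not saturated, the irrelevant ideal `m` would be associated to `R/C`.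
Then `ht I = ht C = ht m`, so that `m` would be the radical of the homogeneous ideal `I`, which is
impossible for a proper saturated ideal.

The dimension formula for affine domains (`height_add_ringKrullDim_quotient`) translates between
heights and the dimensions in the definition of unmixedness.
-/

/-! ### Dimension theory of finitely generated algebras over a field -/

namespace GVD

open MvPolynomial

section Dimension

lemma height_of_isMaximal {κ : Type u} [Field κ] (n : ℕ) (M : Ideal (MvPolynomial (Fin n) κ))
    (hM : M.IsMaximal) : M.height = n := by
  induction n with
  | zero =>
    have h : (M.height : WithBot ℕ∞) ≤ ringKrullDim (MvPolynomial (Fin 0) κ) :=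
      Ideal.height_le_ringKrullDim_of_ne_top hM.ne_top
    rw [MvPolynomial.ringKrullDim_of_isNoetherianRing, ringKrullDim_eq_zero_of_field] at h
    simpa using h
  | succ n ih =>
    let e := (finSuccEquiv κ n).toRingEquiv
    have hM' : (M.map e).IsMaximal := Ideal.map_isMaximal_of_equiv e
    have hp : ((M.map e).comap (Polynomial.C)).IsMaximal :=
      Polynomial.isMaximal_comap_C_of_isJacobsonRing _
    have h1 := ih _ hp
    have : (M.map e).LiesOver ((M.map e).comap (Polynomial.C)) := ⟨rfl⟩
    rw [← RingEquiv.height_map e M,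
      Polynomial.height_eq_height_add_one ((M.map e).comap (Polynomial.C)) (M.map e), h1]
    simp

section Integral

variable {A B : Type*} [CommRing A] [CommRing B] [Algebra A B] [Algebra.IsIntegral A B]

lemma ringKrullDim_le_of_isIntegral : ringKrullDim B ≤ ringKrullDim A :=
  Order.krullDim_le_of_strictMono (PrimeSpectrum.comap (algebraMap A B))
    fun _ _ h ↦ Ideal.IsIntegral.comap_lt_comap h

lemma ringKrullDim_le_of_isIntegral_of_injective [Nontrivial A]
    (h : Function.Injective (algebraMap A B)) : ringKrullDim A ≤ ringKrullDim B := by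
  have : FaithfulSMul A B := (faithfulSMul_iff_algebraMap_injective A B).mpr h
  refine iSup_le fun l ↦ ?_
  obtain ⟨P, hP, hPl⟩ : Nonempty (Ideal.primesOver l.head.asIdeal B) := inferInstance
  obtain ⟨L, hL, -⟩ := Ideal.exists_ltSeries_of_hasGoingUp l P
  exact hL ▸ le_iSup (fun q : LTSeries (PrimeSpectrum B) ↦ (q.length : WithBot ℕ∞)) L

end Integral

lemma height_add_height_map_le {A : Type*} [CommRing A] [IsNoetherianRing A] {P Q : Ideal A}
    [P.IsPrime] [Q.IsPrime] (h : P ≤ Q) :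
    P.height + (Q.map (Ideal.Quotient.mk P)).height ≤ Q.height := by
  have hQ : (Q.map (Ideal.Quotient.mk P)).IsPrime := Ideal.isPrime_map_quotientMk_of_isPrime h
  obtain ⟨l, hl, hlP⟩ := P.exists_ltSeries_length_eq_height
  obtain ⟨l', hl', hlQ⟩ := (Q.map (Ideal.Quotient.mk P)).exists_ltSeries_length_eq_height
  let m : LTSeries (PrimeSpectrum A) := l'.map (PrimeSpectrum.comap (Ideal.Quotient.mk P))
    (RingHom.strictMono_comap_of_surjective Ideal.Quotient.mk_surjective)
  have hm : m.last = ⟨Q, inferInstance⟩ := by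
    ext1
    simp only [m, LTSeries.last_map, hl', PrimeSpectrum.comap_asIdeal]
    rw [Ideal.comap_map_of_surjective _ Ideal.Quotient.mk_surjective, ← RingHom.ker_eq_comap_bot,
      Ideal.mk_ker, sup_eq_left.mpr h]
  have hlm : l.last ≤ m.head := by
    rw [hl, ← PrimeSpectrum.asIdeal_le_asIdeal]
    simp only [m, LTSeries.head_map, PrimeSpectrum.comap_asIdeal]
    conv_lhs => rw [← Ideal.mk_ker (I := P)]
    exact Ideal.ker_le_comap _
  rw [← hlP, ← hlQ, (⟨Q, ‹_›⟩ : PrimeSpectrum A).height_eq_orderHeight]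
  rcases hlm.eq_or_lt with heq | hlt
  · have : (l.smash m heq).length = l.length + l'.length := by simp [m]
    rw [← Nat.cast_add, ← this]
    exact Order.length_le_height (by simp [hm])
  · have : (l.append m hlt).length = l.length + l'.length + 1 := by simp [m]
    refine le_trans ?_ (Order.length_le_height (p := l.append m hlt) (by simp [hm]))
    rw [← Nat.cast_add, this]
    exact_mod_cast Nat.le_succ _

lemma height_add_ringKrullDim_quotient_le {A : Type*} [CommRing A] [IsNoetherianRing A]
    (Q : Ideal A) [Q.IsPrime] :
    (Q.height : WithBot ℕ∞) + ringKrullDim (A ⧸ Q) ≤ ringKrullDim A := by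
  rw [ringKrullDim, Order.krullDim_eq_iSup_height_of_nonempty, ← WithBot.coe_add, ENat.add_iSup,
    WithBot.coe_iSup (OrderTop.bddAbove _)]
  refine iSup_le fun p ↦ ?_
  let q := p.asIdeal.comap (Ideal.Quotient.mk Q)
  have hQq : Q ≤ q := by
    conv_lhs => rw [← Ideal.mk_ker (I := Q)]
    exact Ideal.ker_le_comap _
  have h := height_add_height_map_le hQq
  rw [Ideal.map_comap_of_surjective _ Ideal.Quotient.mk_surjective,
    PrimeSpectrum.height_eq_orderHeight] at h
  exact le_trans (by exact_mod_cast h) (Ideal.height_le_ringKrullDim_of_isPrime (I := q))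

variable (κ : Type u) [Field κ]

/-- Cutting down by a prime of height one lowers the dimension of an affine domain by at most one.
By Noether normalization and going-down, the prime lies over a height one prime of a polynomial
ring, which is principal. -/
lemma ringKrullDim_le_quotient_add_one {A : Type v} [CommRing A] [IsDomain A] [Algebra κ A]
    [Algebra.FiniteType κ A] (P : Ideal A) [P.IsPrime] (hP : P.height = 1) :
    ringKrullDim A ≤ ringKrullDim (A ⧸ P) + 1 := by
  have hA : IsNoetherianRing A := Algebra.FiniteType.isNoetherianRing κ A
  obtain ⟨s, g, hg, hgi⟩ := exists_integral_inj_algHom_of_fg κ A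
  let B := MvPolynomial (Fin s) κ
  algebraize [g.toRingHom]
  have : FaithfulSMul B A := (faithfulSMul_iff_algebraMap_injective B A).mpr hg
  have hP0 : P ≠ ⊥ := Ideal.ne_bot_of_height_eq_one hP
  let p : Ideal B := P.under B
  have hp0 : p ≠ ⊥ := Ideal.IsIntegral.comap_ne_bot B hP0
  obtain ⟨f, hfp, hf⟩ := Ideal.IsPrime.exists_mem_prime_of_ne_bot (I := p) inferInstance hp0
  have hp1 : p.height = 1 := by
    refine le_antisymm ?_ ?_
    · rw [← hP, Ideal.height_eq_height_add_of_liesOver_of_hasGoingDown p P]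
      exact le_self_add
    · rwa [Order.one_le_iff_ne_zero, ne_eq, Ideal.height_eq_zero_iff_eq_bot]
  have hpf := Ideal.eq_span_singleton_of_height_eq_one hp1 hfp hf
  obtain ⟨M, hM, hpM⟩ := Ideal.exists_le_maximal p Ideal.IsPrime.ne_top'
  have h1 := Ideal.height_le_ringKrullDim_quotient_add_one (hpM hfp)
  rw [height_of_isMaximal s M hM, ← hpf] at h1
  calc ringKrullDim A ≤ ringKrullDim B := ringKrullDim_le_of_isIntegral
    _ = s := by simp [B]
    _ ≤ ringKrullDim (B ⧸ p) + 1 := by simpa using h1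
    _ ≤ ringKrullDim (A ⧸ P) + 1 := by
      gcongr
      exact ringKrullDim_le_of_isIntegral_of_injective
        (Ideal.algebraMap_quotient_injective (I := P))

/-- The dimension formula for affine domains, by induction on the height of `Q`: divide by a height
one prime below `Q`. -/
theorem height_add_ringKrullDim_quotient {A : Type v} [CommRing A] [IsDomain A] [Algebra κ A]
    [Algebra.FiniteType κ A] (Q : Ideal A) [Q.IsPrime] :
    (Q.height : WithBot ℕ∞) + ringKrullDim (A ⧸ Q) = ringKrullDim A := by
  have hA : IsNoetherianRing A := Algebra.FiniteType.isNoetherianRing κ A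
  refine le_antisymm (height_add_ringKrullDim_quotient_le Q) ?_
  obtain ⟨n, hn⟩ : ∃ n : ℕ, Q.height = n := by
    obtain ⟨n, hn⟩ := ENat.ne_top_iff_exists.mp Q.height_ne_top_of_isPrime
    exact ⟨n, hn.symm⟩
  induction n using Nat.strong_induction_on generalizing A with | h n ih =>
  by_cases hQ : Q = ⊥
  · subst hQ
    rw [ringKrullDim_eq_of_ringEquiv (RingEquiv.quotientBot A)]
    simp
  obtain ⟨f, hfQ, hf0⟩ := Submodule.exists_mem_ne_zero_of_ne_bot hQ
  obtain ⟨P, hP, hPQ⟩ := Ideal.exists_minimalPrimes_le (I := Ideal.span {f}) (J := Q) (by simpa)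
  have hPp : P.IsPrime := hP.1.1
  have hfP : f ∈ P := hP.1.2 (Ideal.mem_span_singleton_self f)
  have hP1 : P.height = 1 := by
    refine le_antisymm (Ideal.height_le_one_of_isPrincipal_of_mem_minimalPrimes _ P hP) ?_
    rw [Order.one_le_iff_ne_zero, ne_eq, Ideal.height_eq_zero_iff_eq_bot]
    rintro rfl
    exact hf0 (by simpa using hfP)
  let Q' := Q.map (Ideal.Quotient.mk P)
  have hQ' : Q'.IsPrime := Ideal.isPrime_map_quotientMk_of_isPrime hPQ
  have hle : 1 + Q'.height ≤ Q.height := hP1 ▸ height_add_height_map_le hPQ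
  obtain ⟨m, hm⟩ := ENat.ne_top_iff_exists.mp Q'.height_ne_top_of_isPrime
  have hmn : 1 + m ≤ n := by
    rw [← hm, hn] at hle
    exact_mod_cast hle
  have h1 := ih m (by omega) Q' inferInstance hm.symm
  rw [ringKrullDim_eq_of_ringEquiv (DoubleQuot.quotQuotEquivQuotOfLE hPQ)] at h1
  calc ringKrullDim A ≤ ringKrullDim (A ⧸ P) + 1 := ringKrullDim_le_quotient_add_one κ P hP1
    _ ≤ (Q'.height + ringKrullDim (A ⧸ Q)) + 1 := by gcongr
    _ = ((1 + Q'.height : ℕ∞) : WithBot ℕ∞) + ringKrullDim (A ⧸ Q) := by push_cast; ring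
    _ ≤ _ := by
      gcongr
      exact_mod_cast hle

end Dimension

/-! ### Associated primes of Cohen–Macaulay rings -/

section Depth

open IsLocalRing RingTheory.Sequence Pointwise

/-- If `x ∈ 𝔪` is a nonzerodivisor on `M`, every associated prime of `M` is strictly contained in an
associated prime of `M / xM`: the submodule `K` of elements killed by `P` satisfies
`K ∩ xM = xK`, and `xK ≠ K` by Nakayama's lemma. -/
lemma exists_lt_mem_associatedPrimes_quotSMulTop {B : Type u} [CommRing B] [IsNoetherianRing B]
    [IsLocalRing B] {M : Type v} [AddCommGroup M] [Module B M] [Module.Finite B M]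
    {P : Ideal B} (hP : P ∈ associatedPrimes B M) {x : B} (hx : x ∈ maximalIdeal B)
    (hreg : IsSMulRegular M x) :
    ∃ Q ∈ associatedPrimes B (QuotSMulTop x M), P < Q := by
  obtain ⟨hPp, m, hm⟩ := (isAssociatedPrime_iff).mp hP
  have hxP : x ∉ P := by
    intro hxP
    rw [hm, Submodule.mem_colon_singleton, Submodule.mem_bot] at hxP
    apply hPp.ne_top
    rw [hm, hreg.right_eq_zero_of_smul hxP]
    simp
  let K : Submodule B M := ⨅ p : P, LinearMap.ker (LinearMap.lsmul B M p)
  have hK (z : M) : z ∈ K ↔ ∀ p ∈ P, p • z = 0 := by simp [K]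
  have hmK : m ∈ K := by
    rw [hK]
    intro p hp
    rwa [hm, Submodule.mem_colon_singleton, Submodule.mem_bot] at hp
  obtain ⟨z, hzK, hz⟩ : ∃ z ∈ K, z ∉ x • (⊤ : Submodule B M) := by
    by_contra! hcon
    have hle : K ≤ Ideal.span {x} • K := by
      intro z hz
      obtain ⟨w, -, rfl⟩ := (Submodule.mem_smul_pointwise_iff_exists _ _ _).mp (hcon z hz)
      rw [Submodule.ideal_span_singleton_smul]
      refine Submodule.smul_mem_pointwise_smul _ _ _ ((hK w).mpr fun p hp ↦ ?_)
      apply hreg.right_eq_zero_of_smul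
      rw [smul_comm]
      exact (hK _).mp hz p hp
    have hK0 : K = ⊥ := Submodule.eq_bot_of_le_smul_of_le_jacobson_bot _ _
      (IsNoetherian.noetherian K) hle (by
        rw [Ideal.span_singleton_le_iff_mem, jacobson_eq_maximalIdeal _ bot_ne_top]
        exact hx)
    apply hPp.ne_top
    have hm0 : m = 0 := by simpa [hK0] using hmK
    rw [hm, hm0]
    simp
  have hz0 : (Submodule.Quotient.mk z : QuotSMulTop x M) ≠ 0 := by
    rwa [ne_eq, Submodule.Quotient.mk_eq_zero]
  obtain ⟨Q, hQ, hzQ⟩ := exists_le_isAssociatedPrime_of_isNoetherianRing B _ hz0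
  refine ⟨Q, hQ, lt_of_le_of_ne (fun p hp ↦ hzQ ?_) ?_⟩
  · rw [Submodule.mem_colon_singleton, Submodule.mem_bot, ← Submodule.Quotient.mk_smul,
      (hK z).mp hzK p hp, Submodule.Quotient.mk_zero]
  · rintro rfl
    refine hxP (hzQ ?_)
    rw [Submodule.mem_colon_singleton, Submodule.mem_bot, ← Submodule.Quotient.mk_smul,
      Submodule.Quotient.mk_eq_zero]
    exact Submodule.smul_mem_pointwise_smul _ _ _ trivial

/-- The depth of a module is at most the dimension of each of its associated primes. -/
lemma length_le_ringKrullDim_quotient {B : Type u} [CommRing B] [IsNoetherianRing B]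
    [IsLocalRing B] (rs : List B) (hrs : ∀ r ∈ rs, r ∈ maximalIdeal B)
    {M : Type v} [AddCommGroup M] [Module B M] [Module.Finite B M] (hreg : IsRegular M rs)
    {P : Ideal B} (hP : P ∈ associatedPrimes B M) :
    (rs.length : WithBot ℕ∞) ≤ ringKrullDim (B ⧸ P) := by
  induction rs generalizing M P with
  | nil =>
    have : P.IsPrime := hP.1
    simpa using ringKrullDim_nonneg_of_nontrivial
  | cons x rs ih =>
    have : P.IsPrime := hP.1
    obtain ⟨hx, hreg'⟩ := (isRegular_cons_iff M x rs).mp hreg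
    obtain ⟨Q, hQ, hPQ⟩ := exists_lt_mem_associatedPrimes_quotSMulTop hP (hrs x (by simp)) hx
    have hQp : Q.IsPrime := hQ.1
    have h1 := ih (fun r hr ↦ hrs r (by simp [hr])) hreg' hQ
    obtain ⟨y, hyQ, hyP⟩ := Set.exists_of_ssubset hPQ
    have h2 : ringKrullDim (B ⧸ Q) + 1 ≤ ringKrullDim (B ⧸ P) := by
      refine ringKrullDim_succ_le_of_surjective (Ideal.Quotient.factor hPQ.le)
        (Ideal.Quotient.factor_surjective hPQ.le) (r := Ideal.Quotient.mk P y) ?_ ?_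
      · exact mem_nonZeroDivisors_of_ne_zero (by rwa [ne_eq, Ideal.Quotient.eq_zero_iff_mem])
      · simpa [Ideal.Quotient.eq_zero_iff_mem] using hyQ
    refine le_trans ?_ h2
    push_cast [List.length_cons]
    gcongr

end Depth

section CohenMacaulay

variable {A : Type u} [CommRing A]

open IsLocalRing RingTheory.Sequence Pointwise

lemma ringKrullDim_localization_quotient_le (p q : Ideal A) [p.IsPrime] [q.IsPrime] (h : p ≤ q) :
    ringKrullDim (Localization.AtPrime q ⧸ p.map (algebraMap A (Localization.AtPrime q))) ≤
      (q.map (Ideal.Quotient.mk p)).height := by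
  let B := Localization.AtPrime q
  let pB := p.map (algebraMap A B)
  have hq : (q.map (Ideal.Quotient.mk p)).IsPrime := Ideal.isPrime_map_quotientMk_of_isPrime h
  let g : A ⧸ p →+* B ⧸ pB := Ideal.quotientMap pB (algebraMap A B) Ideal.le_comap_map
  have hg (J : Ideal (B ⧸ pB)) : ((J.comap (Ideal.Quotient.mk pB)).comap (algebraMap A B)) =
      (J.comap g).comap (Ideal.Quotient.mk p) := by
    rw [Ideal.comap_comap, Ideal.comap_comap]
    rfl
  have hinj : StrictMono (PrimeSpectrum.comap g) := by
    refine Monotone.strictMono_of_injective (fun _ _ h ↦ Ideal.comap_mono h) fun x y hxy ↦ ?_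
    have h1 := congrArg (PrimeSpectrum.comap (Ideal.Quotient.mk p)) hxy
    rw [PrimeSpectrum.ext_iff] at h1 ⊢
    simp only [PrimeSpectrum.comap_asIdeal, ← hg] at h1
    have h2 := congrArg (Ideal.map (algebraMap A B)) h1
    rw [IsLocalization.map_under q.primeCompl, IsLocalization.map_under q.primeCompl] at h2
    exact Ideal.comap_injective_of_surjective _ Ideal.Quotient.mk_surjective h2
  rw [(⟨_, hq⟩ : PrimeSpectrum (A ⧸ p)).height_eq_orderHeight]
  refine iSup_le fun l ↦ ?_
  rw [← LTSeries.map_length l _ hinj]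
  refine WithBot.coe_le_coe.mpr (Order.length_le_height ?_)
  rw [LTSeries.last_map, ← PrimeSpectrum.asIdeal_le_asIdeal, PrimeSpectrum.comap_asIdeal]
  intro x hx
  obtain ⟨a, rfl⟩ := Ideal.Quotient.mk_surjective x
  apply Ideal.mem_map_of_mem
  have h3 : a ∈ (l.last.asIdeal.comap (Ideal.Quotient.mk pB)).comap (algebraMap A B) := by
    rw [hg]
    exact hx
  by_contra haq
  have h4 := le_maximalIdeal (Ideal.IsPrime.ne_top inferInstance) (Ideal.mem_comap.mp h3)
  exact h4 (IsLocalization.map_units B (⟨a, haq⟩ : q.primeCompl))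

/-- The localization of a Cohen–Macaulay ring at `q` has depth `ht q`, and the depth is at most the
dimension modulo the associated prime `p`, which is the height of `q/p`. -/
lemma IsCohenMacaulayRing.height_le (hA : IsCohenMacaulayRing A) {p q : Ideal A}
    (hp : p ∈ associatedPrimes A A) [q.IsPrime] (h : p ≤ q) :
    haveI : p.IsPrime := hp.1
    q.height ≤ (q.map (Ideal.Quotient.mk p)).height := by
  have hpp : p.IsPrime := hp.1
  have := hA.1
  obtain ⟨hB, rs, hreg, hrs, hdim⟩ := hA.2 q
  let B := Localization.AtPrime q
  have hc : (p.map (algebraMap A B)).comap (algebraMap A B) = p :=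
    IsLocalization.under_map_of_isPrime_disjoint q.primeCompl B hpp
      (Set.disjoint_left.mpr fun x hx hxp ↦ hx (h hxp))
  have hass : p.map (algebraMap A B) ∈ associatedPrimes B B :=
    Module.associatedPrimes.mem_associatedPrimes_of_comap_mem_associatedPrimes_of_isLocalizedModule
      q.primeCompl (Algebra.linearMap A B) _ (by rwa [hc])
  have h1 := length_le_ringKrullDim_quotient rs hrs hreg hass
  rw [hdim, IsLocalization.AtPrime.ringKrullDim_eq_height q] at h1
  exact_mod_cast h1.trans (ringKrullDim_localization_quotient_le p q h)

lemma IsCohenMacaulayRing.mem_minimalPrimes (hA : IsCohenMacaulayRing A) {p : Ideal A}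
    (hp : p ∈ associatedPrimes A A) : p ∈ minimalPrimes A := by
  have hpp : p.IsPrime := hp.1
  have h := hA.height_le hp le_rfl
  rw [Ideal.map_quotient_self, Ideal.height_bot] at h
  rw [← Ideal.height_eq_zero_iff]
  exact le_antisymm h bot_le

/-- A Cohen–Macaulay local ring of dimension at least two has depth at least two. The statement is
about the localization at `q`, with denominators cleared. -/
lemma IsCohenMacaulayRing.exists_regular_pair (hA : IsCohenMacaulayRing A) {q : Ideal A}
    [q.IsPrime] (h : 2 ≤ q.height) :
    ∃ a ∈ q, ∃ b ∈ q, (∀ x, a * x = 0 → ∃ t ∉ q, t * x = 0) ∧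
      ∀ x y, b * x = a * y → ∃ t ∉ q, ∃ e, t * x = a * e := by
  obtain ⟨hB, rs, hreg, hrs, hdim⟩ := hA.2 q
  let B := Localization.AtPrime q
  rw [IsLocalization.AtPrime.ringKrullDim_eq_height q] at hdim
  obtain ⟨a, b, rs, rfl⟩ : ∃ a b rs', rs = a :: b :: rs' := by
    have : 2 ≤ rs.length := by
      have h' : ((2 : ℕ∞) : WithBot ℕ∞) ≤ q.height := WithBot.coe_le_coe.mpr h
      rw [← hdim] at h'
      exact_mod_cast h'
    match rs, this with
    | a :: b :: rs', _ => exact ⟨a, b, rs', rfl⟩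
  obtain ⟨ha, hreg'⟩ := (isRegular_cons_iff _ _ _).mp hreg
  obtain ⟨hb, -⟩ := (isRegular_cons_iff _ _ _).mp hreg'
  have ham := hrs a (by simp)
  have hbm := hrs b (by simp)
  rw [isSMulRegular_quotient_iff_mem_of_smul_mem] at hb
  obtain ⟨a, sa, rfl⟩ := IsLocalization.exists_mk'_eq q.primeCompl a
  obtain ⟨b, sb, rfl⟩ := IsLocalization.exists_mk'_eq q.primeCompl b
  have hloc : IsLocalization q.primeCompl B := Localization.isLocalization
  refine ⟨a, ?_, b, ?_, fun x hx ↦ ?_, fun x y hxy ↦ ?_⟩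
  · exact (IsLocalization.AtPrime.mk'_mem_maximal_iff B q a sa).mp ham
  · exact (IsLocalization.AtPrime.mk'_mem_maximal_iff B q b sb).mp hbm
  · have hx0 : algebraMap A B x = 0 := by
      apply ha.right_eq_zero_of_smul
      rw [smul_eq_mul, mul_comm, ← IsLocalization.mk'_one (M := q.primeCompl) B x,
        ← IsLocalization.mk'_mul, mul_comm x, hx, IsLocalization.mk'_zero]
    obtain ⟨t, ht⟩ := (IsLocalization.map_eq_zero_iff q.primeCompl B x).mp hx0
    exact ⟨t, t.2, ht⟩
  · have h1 : IsLocalization.mk' B b sb • algebraMap A B x ∈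
        IsLocalization.mk' B a sa • (⊤ : Submodule B B) := by
      rw [Submodule.mem_smul_pointwise_iff_exists]
      refine ⟨IsLocalization.mk' B (sa * y) sb, trivial, ?_⟩
      rw [smul_eq_mul, smul_eq_mul, ← IsLocalization.mk'_mul,
        ← IsLocalization.mk'_one (M := q.primeCompl) B x, ← IsLocalization.mk'_mul,
        IsLocalization.mk'_eq_iff_eq]
      congr 1
      simp only [Submonoid.coe_mul, Submonoid.coe_one]
      linear_combination (-(sa * sb : A)) * hxy
    obtain ⟨e, -, he⟩ := (Submodule.mem_smul_pointwise_iff_exists _ _ _).mp (hb _ h1)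
    obtain ⟨e, se, rfl⟩ := IsLocalization.exists_mk'_eq q.primeCompl e
    rw [smul_eq_mul, ← IsLocalization.mk'_mul, ← IsLocalization.mk'_one (M := q.primeCompl) B x,
      IsLocalization.mk'_eq_iff_eq, IsLocalization.eq_iff_exists q.primeCompl] at he
    obtain ⟨t, ht⟩ := he
    refine ⟨t * (sa * se), ?_, t * e, ?_⟩
    · exact (t * (sa * se)).2
    · simp only [Submonoid.coe_mul, Submonoid.coe_one] at ht
      linear_combination -ht

end CohenMacaulay

/-! ### Expansion of polynomials in powers of one variable -/

section Expansion

variable {κ : Type u} [Field κ] {n : ℕ} (j : Fin n)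

/-- The expansion of a polynomial in powers of `y = X j`, as a polynomial in a new variable whose
coefficients are polynomials not involving `y`. The coefficients are kept in the original ring
`κ[x₁, …, xₙ]`. -/
noncomputable def yExpand : MvPolynomial (Fin n) κ →ₐ[κ] Polynomial (MvPolynomial (Fin n) κ) :=
  aeval fun i ↦ if i = j then Polynomial.X else Polynomial.C (X i)

lemma yExpand_monomial (s : Fin n →₀ ℕ) (c : κ) :
    yExpand j (monomial s c) = Polynomial.monomial (s j) (monomial (s.erase j) c) := by
  rw [← Polynomial.C_mul_X_pow_eq_monomial, yExpand, aeval_monomial,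
    ← Finsupp.mul_prod_erase' s j _ (by simp), monomial_eq, if_pos rfl, Polynomial.C_mul,
    Finsupp.prod, Finsupp.prod, map_prod, mul_left_comm]
  have h : ∏ i ∈ (s.erase j).support, (if i = j then Polynomial.X else Polynomial.C (X i)) ^
      (s.erase j) i = ∏ i ∈ (s.erase j).support,
        Polynomial.C (X i ^ (s.erase j) i : MvPolynomial (Fin n) κ) := by
    refine Finset.prod_congr rfl fun i hi ↦ ?_
    rw [if_neg (by rintro rfl; simp at hi), Polynomial.C_pow]
  rw [h, mul_comm (Polynomial.X ^ _)]
  simp only [mul_assoc]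
  rfl

lemma yExpand_eq_sum (f : MvPolynomial (Fin n) κ) :
    yExpand j f =
      ∑ s ∈ f.support, Polynomial.monomial (s j) (monomial (s.erase j) (f.coeff s)) := by
  conv_lhs => rw [f.as_sum, map_sum]
  simp only [yExpand_monomial]

lemma coeff_yExpand (f : MvPolynomial (Fin n) κ) (d : ℕ) :
    (yExpand j f).coeff d =
      ∑ s ∈ f.support with s j = d, monomial (s.erase j) (f.coeff s) := by
  simp [yExpand_eq_sum, Polynomial.coeff_monomial, Finset.sum_filter]

lemma eval_yExpand (f : MvPolynomial (Fin n) κ) : (yExpand j f).eval (X j) = f := by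
  have h : ((Polynomial.aeval (R := MvPolynomial (Fin n) κ) (X j)).restrictScalars κ).comp
      (yExpand j) = AlgHom.id κ (MvPolynomial (Fin n) κ) := by
    ext i
    by_cases hi : i = j <;> simp [yExpand, hi]
  simpa using congrArg (fun φ : _ →ₐ[κ] _ ↦ φ f) h

lemma yExpand_coeff (f : MvPolynomial (Fin n) κ) (d : ℕ) :
    yExpand j ((yExpand j f).coeff d) = Polynomial.C ((yExpand j f).coeff d) := by
  rw [coeff_yExpand, map_sum, map_sum]
  refine Finset.sum_congr rfl fun s _ ↦ ?_
  simp [yExpand_monomial]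

@[simp]
lemma yExpand_X_self : yExpand j (X j : MvPolynomial (Fin n) κ) = Polynomial.X := by
  simp [yExpand]

lemma yExpand_X_of_ne {i : Fin n} (h : i ≠ j) :
    yExpand j (X i : MvPolynomial (Fin n) κ) = Polynomial.C (X i) := by
  simp [yExpand, h]

lemma natDegree_yExpand (f : MvPolynomial (Fin n) κ) :
    (yExpand j f).natDegree = f.degreeOf j := by
  apply le_antisymm
  · rw [Polynomial.natDegree_le_iff_coeff_eq_zero]
    intro d hd
    rw [coeff_yExpand, Finset.sum_eq_zero]
    intro s hs
    rw [Finset.mem_filter] at hs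
    have := monomial_le_degreeOf j hs.1
    omega
  · have h0 (d : ℕ) : ((yExpand j f).coeff d).degreeOf j = 0 := by
      rw [coeff_yExpand, ← Nat.le_zero]
      refine (degreeOf_sum_le _ _ _).trans (Finset.sup_le fun s _ ↦ ?_)
      rw [degreeOf_le_iff]
      intro t ht
      rw [Finset.mem_singleton.mp (support_monomial_subset ht)]
      simp
    conv_lhs => rw [← eval_yExpand j f, Polynomial.eval_eq_sum_range]
    refine (degreeOf_sum_le _ _ _).trans (Finset.sup_le fun d hd ↦ ?_)
    refine (degreeOf_mul_le _ _ _).trans ?_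
    rw [h0, zero_add]
    refine (degreeOf_pow_le _ _ _).trans ?_
    rw [degreeOf_X_self, mul_one]
    exact Nat.lt_succ_iff.mp (Finset.mem_range.mp hd)

lemma initialCoeff_eq (f : MvPolynomial (Fin n) κ) :
    initialCoeff j f = (yExpand j f).coeff (yExpand j f).natDegree := by
  rw [natDegree_yExpand, coeff_yExpand, initialCoeff]

lemma yExpand_initialForm (f : MvPolynomial (Fin n) κ) :
    yExpand j (initialForm j f) = Polynomial.monomial (yExpand j f).natDegree
      ((yExpand j f).coeff (yExpand j f).natDegree) := by
  rw [natDegree_yExpand, coeff_yExpand, initialForm, map_sum, map_sum]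
  refine Finset.sum_congr rfl fun s hs ↦ ?_
  rw [yExpand_monomial, (Finset.mem_filter.mp hs).2]

/-- Polynomials not involving `y`. -/
def IsYFree (f : MvPolynomial (Fin n) κ) : Prop := yExpand j f = Polynomial.C f

variable {j}

lemma isYFree_of_natDegree_eq_zero {f : MvPolynomial (Fin n) κ}
    (h : (yExpand j f).natDegree = 0) : IsYFree j f := by
  have h1 := Polynomial.eq_C_of_natDegree_eq_zero h
  have h2 := eval_yExpand j f
  rw [h1, Polynomial.eval_C] at h2
  rw [IsYFree, h1, h2]

lemma isYFree_coeff (f : MvPolynomial (Fin n) κ) (d : ℕ) : IsYFree j ((yExpand j f).coeff d) :=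
  yExpand_coeff j f d

/-- A polynomial of degree at most one in `y` is `q y + r` with `q` and `r` free of `y`. -/
lemma eq_of_natDegree_le_one {f : MvPolynomial (Fin n) κ} (h : (yExpand j f).natDegree ≤ 1) :
    f = (yExpand j f).coeff 1 * X j + (yExpand j f).coeff 0 := by
  conv_lhs => rw [← eval_yExpand j f, Polynomial.eq_X_add_C_of_natDegree_le_one h]
  simp

lemma sub_natDegree_lt {f g : MvPolynomial (Fin n) κ} {k : ℕ} (hk : 0 < k)
    (hf : (yExpand j f).natDegree ≤ k) (hg : (yExpand j g).natDegree ≤ k)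
    (h : (yExpand j f).coeff k = (yExpand j g).coeff k) : (yExpand j (f - g)).natDegree < k := by
  rw [map_sub, Nat.lt_iff_le_pred hk, Polynomial.natDegree_le_iff_coeff_eq_zero]
  intro d hd
  rw [Polynomial.coeff_sub]
  rcases (show k ≤ d by omega).eq_or_lt with rfl | hd'
  · rw [h, sub_self]
  · rw [Polynomial.coeff_eq_zero_of_natDegree_lt (hf.trans_lt hd'),
      Polynomial.coeff_eq_zero_of_natDegree_lt (hg.trans_lt hd'), sub_self]

variable (j) in
/-- The ideal `J` is extended from the polynomial ring in the variables other than `y`: it contains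
the coefficients of the expansions of its elements in powers of `y`. -/
def IsYExtended (J : Ideal (MvPolynomial (Fin n) κ)) : Prop :=
  ∀ f ∈ J, ∀ d, (yExpand j f).coeff d ∈ J

lemma isYExtended_span {S : Set (MvPolynomial (Fin n) κ)} (hS : ∀ f ∈ S, IsYFree j f) :
    IsYExtended j (Ideal.span S) := by
  have h : Ideal.span S ≤ ((Ideal.span S).map Polynomial.C).comap (yExpand j) := by
    rw [Ideal.span_le]
    intro f hf
    rw [SetLike.mem_coe, Ideal.mem_comap, hS f hf]
    exact Ideal.mem_map_of_mem _ (Ideal.subset_span hf)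
  exact fun f hf ↦ Ideal.mem_map_C_iff.mp (h hf)

end Expansion

section Grading

variable {κ : Type u} [Field κ] {n : ℕ} {j : Fin n}

attribute [local instance] MvPolynomial.gradedAlgebra

lemma coe_decompose (f : MvPolynomial (Fin n) κ) (e : ℕ) :
    (DirectSum.decompose (homogeneousSubmodule (Fin n) κ) f e : MvPolynomial (Fin n) κ) =
      homogeneousComponent e f :=
  decomposition.decompose'_apply f e

lemma homogeneousComponent_mul_add {q : MvPolynomial (Fin n) κ} {k : ℕ} (hq : q.IsHomogeneous k)
    (f : MvPolynomial (Fin n) κ) (e : ℕ) :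
    homogeneousComponent (k + e) (q * f) = q * homogeneousComponent e f := by
  have h := DirectSum.coe_decompose_mul_add_of_left_mem (homogeneousSubmodule (Fin n) κ)
    (i := k) (j := e) (a := q) (b := f) hq
  rwa [coe_decompose, coe_decompose] at h

lemma homogeneousComponent_mul_eq_zero {q : MvPolynomial (Fin n) κ} {k : ℕ}
    (hq : q.IsHomogeneous k) (f : MvPolynomial (Fin n) κ) {e : ℕ} (h : e < k) :
    homogeneousComponent e (q * f) = 0 := by
  have h := DirectSum.coe_decompose_mul_of_left_mem_of_not_le (homogeneousSubmodule (Fin n) κ)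
    (i := k) (n := e) (a := q) (b := f) hq h.not_ge
  rwa [coe_decompose] at h

lemma isHomogeneousIdeal_iff {J : Ideal (MvPolynomial (Fin n) κ)} :
    IsHomogeneousIdeal J ↔ ∀ f ∈ J, ∀ e, homogeneousComponent e f ∈ J := by
  constructor
  · intro h f hf e
    exact coe_decompose f e ▸ h e hf
  · intro h e f hf
    rw [coe_decompose]
    exact h f hf e

lemma isHomogeneousIdeal_span {S : Set (MvPolynomial (Fin n) κ)}
    (hS : ∀ f ∈ S, ∃ e, f.IsHomogeneous e) : IsHomogeneousIdeal (Ideal.span S) :=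
  Ideal.homogeneous_span _ S hS

lemma coeff_yExpand_isHomogeneous {f : MvPolynomial (Fin n) κ} {d e : ℕ}
    (hf : f.IsHomogeneous (d + e)) : ((yExpand j f).coeff d).IsHomogeneous e := by
  rw [coeff_yExpand]
  refine IsHomogeneous.sum _ _ _ fun s hs ↦ isHomogeneous_monomial _ ?_
  rw [Finset.mem_filter, mem_support_iff] at hs
  have h : Finsupp.degree s = d + e := by
    rw [Finsupp.degree_eq_weight_one]
    exact hf hs.1
  rw [← Finsupp.single_add_erase j s, map_add,
    Finsupp.degree_single, hs.2] at h
  omega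

lemma coeff_yExpand_eq_zero {f : MvPolynomial (Fin n) κ} {d e : ℕ} (hf : f.IsHomogeneous e)
    (h : e < d) : (yExpand j f).coeff d = 0 := by
  rw [coeff_yExpand, Finset.sum_eq_zero]
  intro s hs
  rw [Finset.mem_filter, mem_support_iff] at hs
  have h : Finsupp.degree s = e := by
    rw [Finsupp.degree_eq_weight_one]
    exact hf hs.1
  have := Finsupp.le_degree j s
  omega

lemma natDegree_yExpand_homogeneousComponent_le (f : MvPolynomial (Fin n) κ) (e : ℕ) :
    (yExpand j (homogeneousComponent e f)).natDegree ≤ (yExpand j f).natDegree := by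
  rw [natDegree_yExpand, natDegree_yExpand, degreeOf_le_iff]
  intro s hs
  rw [support_homogeneousComponent] at hs
  exact monomial_le_degreeOf j (Finset.mem_filter.mp hs).1

end Grading

/-! ### The ideals read off from a Gröbner basis -/

section Groebner

variable {κ : Type u} [Field κ] {n : ℕ} {j : Fin n} {lt : MonomialOrder.{0, v} (Fin n)}
  {G : Finset (MvPolynomial (Fin n) κ)} {I : Ideal (MvPolynomial (Fin n) κ)}

lemma IsCompatible.degree_apply (hlt : IsCompatible κ j lt) {f : MvPolynomial (Fin n) κ}
    (hf : f ≠ 0) : lt.degree f j = f.degreeOf j := by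
  classical
  have h0 : initialForm j f ≠ 0 := by
    intro h
    have := hlt f
    rw [h, MonomialOrder.leadingTerm_zero, MonomialOrder.leadingTerm_eq_zero_iff] at this
    exact hf this
  have h1 : lt.degree f = lt.degree (initialForm j f) := by
    rw [← lt.degree_leadingTerm, hlt f, lt.degree_leadingTerm]
  have h2 := lt.degree_mem_support h0
  rw [← h1, initialForm] at h2
  obtain ⟨s, hs, hs'⟩ := Finset.mem_biUnion.mp (support_sum h2)
  rw [Finset.mem_singleton.mp (support_monomial_subset hs')]
  exact (Finset.mem_filter.mp hs).2

lemma IsGroebnerBasis.exists_degree_le (hG : IsGroebnerBasis lt G I) {f : MvPolynomial (Fin n) κ}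
    (hf : f ∈ I) (hf0 : f ≠ 0) : ∃ g ∈ G, g ≠ 0 ∧ lt.degree g ≤ lt.degree f := by
  classical
  have h1 : lt.leadingTerm f ∈ Ideal.span (lt.leadingTerm '' (I : Set (MvPolynomial (Fin n) κ))) :=
    Ideal.subset_span ⟨f, hf, rfl⟩
  have h2 : Ideal.span (lt.leadingTerm '' (G : Set (MvPolynomial (Fin n) κ))) ≤
      Ideal.span ((fun s ↦ monomial s (1 : κ)) '' (lt.degree '' {g | g ∈ G ∧ g ≠ 0})) := by
    rw [Ideal.span_le]
    rintro _ ⟨g, hg, rfl⟩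
    by_cases hg0 : g = 0
    · simp [hg0, MonomialOrder.leadingTerm_zero]
    rw [MonomialOrder.leadingTerm, ← mul_one (lt.leadingCoeff g), ← C_mul_monomial]
    exact Ideal.mul_mem_left _ _ (Ideal.subset_span ⟨_, ⟨g, ⟨hg, hg0⟩, rfl⟩, rfl⟩)
  rw [← hG.2] at h1
  obtain ⟨_, ⟨g, hg, rfl⟩, hle⟩ := mem_ideal_span_monomial_image.mp (h2 h1) (lt.degree f) (by
    rw [lt.support_leadingTerm, if_neg hf0]
    simp)
  exact ⟨g, hg.1, hg.2, hle⟩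

/-- One step of the division algorithm by a Gröbner basis. -/
lemma IsGroebnerBasis.exists_reduction (hG : IsGroebnerBasis lt G I)
    {f : MvPolynomial (Fin n) κ} (hf : f ∈ I) (hf0 : f ≠ 0) :
    ∃ g ∈ G, g ≠ 0 ∧ ∃ (t : Fin n →₀ ℕ) (c : κ), t + lt.degree g = lt.degree f ∧
      (f - monomial t c * g = 0 ∨
        lt.toSyn (lt.degree (f - monomial t c * g)) < lt.toSyn (lt.degree f)) := by
  obtain ⟨g, hgG, hg0, hle⟩ := hG.exists_degree_le hf hf0
  have hu : IsUnit (lt.leadingCoeff g) :=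
    (MonomialOrder.leadingCoeff_ne_zero_iff.mpr hg0).isUnit
  refine ⟨g, hgG, hg0, lt.degree f - lt.degree g, hu.unit⁻¹ * lt.leadingCoeff f,
    tsub_add_cancel_of_le hle, ?_⟩
  by_cases h0 : lt.degree f = 0
  -- the leading terms of the constants `f` and `g` are `f` and `g` themselves, and cancel
  · left
    have hg : lt.degree g = 0 := by simpa [h0] using hle
    have hge := MonomialOrder.degree_eq_zero_iff.mp hg
    have hfe := MonomialOrder.degree_eq_zero_iff.mp h0
    have hc : ((hu.unit⁻¹ : κˣ) : κ) * lt.leadingCoeff g = 1 := hu.val_inv_mul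
    generalize ((hu.unit⁻¹ : κˣ) : κ) = c at hc ⊢
    rw [h0, hg, tsub_zero, ← C_apply, sub_eq_zero]
    calc f = C (lt.leadingCoeff f) := hfe
      _ = C (c * lt.leadingCoeff f) * C (lt.leadingCoeff g) := by
        rw [← C_mul, mul_right_comm, hc, one_mul]
      _ = C (c * lt.leadingCoeff f) * g := by rw [← hge]
  · exact Or.inr (lt.degree_reduce_lt hu hle h0)

lemma coeff_monomial_mul_mem {J : Ideal (MvPolynomial (Fin n) κ)} {g : MvPolynomial (Fin n) κ}
    (hg : initialCoeff j g ∈ J) (t : Fin n →₀ ℕ) (c : κ) {d : ℕ} (hd : t j + g.degreeOf j ≤ d) :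
    (yExpand j (monomial t c * g)).coeff d ∈ J := by
  obtain ⟨e, rfl⟩ := Nat.exists_eq_add_of_le hd
  rw [map_mul, yExpand_monomial, show t j + g.degreeOf j + e = (g.degreeOf j + e) + t j by ring,
    Polynomial.coeff_monomial_mul]
  apply Ideal.mul_mem_left
  rcases Nat.eq_zero_or_pos e with rfl | he
  · rwa [initialCoeff_eq, natDegree_yExpand] at hg
  · rw [Polynomial.coeff_eq_zero_of_natDegree_lt]
    · exact J.zero_mem
    · rw [natDegree_yExpand]
      omega

lemma initialCoeff_eq_self {g : MvPolynomial (Fin n) κ} (hg : g.degreeOf j = 0) :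
    initialCoeff j g = g := by
  have h := isYFree_of_natDegree_eq_zero ((natDegree_yExpand j g).trans hg)
  rw [initialCoeff_eq, h]
  simp

/-- The division algorithm, followed on leading coefficients in `y`. Since the order is
`y`-compatible, no step raises the degree in `y`. -/
lemma IsGroebnerBasis.division (hlt : IsCompatible κ j lt) (hG : IsGroebnerBasis lt G I)
    {f : MvPolynomial (Fin n) κ} (hf : f ∈ I) :
    (∀ d, f.degreeOf j ≤ d → (yExpand j f).coeff d ∈ cIdeal j G) ∧
      (f.degreeOf j = 0 → f ∈ nIdeal j G) := by
  induction h : lt.toSyn (lt.degree f) using WellFoundedLT.induction generalizing f with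
  | ind a ih =>
  by_cases hf0 : f = 0
  · subst hf0
    simp
  obtain ⟨g, hgG, hg0, t, c, ht, hlt'⟩ := hG.exists_reduction hf hf0
  have hg : g ∈ I := hG.1 g hgG
  have htj : t j + g.degreeOf j = f.degreeOf j := by
    rw [← hlt.degree_apply hf0, ← ht, Finsupp.add_apply, hlt.degree_apply hg0]
  set f' := f - monomial t c * g with hf'
  have hfe : f = f' + monomial t c * g := by rw [hf', sub_add_cancel]
  have hf'I : f' ∈ I := I.sub_mem hf (I.mul_mem_left _ hg)
  have hdeg : f'.degreeOf j ≤ f.degreeOf j := by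
    refine (degreeOf_sub_le _ _ _).trans (max_le le_rfl ?_)
    refine (degreeOf_mul_le _ _ _).trans ?_
    rw [← htj]
    gcongr
    rw [degreeOf_le_iff]
    intro s hs
    rw [Finset.mem_singleton.mp (support_monomial_subset hs)]
  have key : (∀ d, f'.degreeOf j ≤ d → (yExpand j f').coeff d ∈ cIdeal j G) ∧
      (f'.degreeOf j = 0 → f' ∈ nIdeal j G) := by
    rcases hlt' with h0 | hlt'
    · rw [h0]
      simp
    · exact ih _ (h ▸ hlt') hf'I rfl
  refine ⟨fun d hd ↦ ?_, fun h0 ↦ ?_⟩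
  · rw [hfe, map_add, Polynomial.coeff_add]
    refine Ideal.add_mem _ (key.1 d (hdeg.trans hd)) ?_
    exact coeff_monomial_mul_mem (J := cIdeal j G) (Ideal.subset_span ⟨g, hgG, rfl⟩) t c
      (htj.trans_le hd)
  · rw [hfe]
    refine Ideal.add_mem _ (key.2 (by omega)) (Ideal.mul_mem_left _ _ (Ideal.subset_span ?_))
    have hg0 : g.degreeOf j = 0 := by omega
    exact ⟨g, hgG, hg0, (initialCoeff_eq_self hg0).symm⟩

/-- The ideal `C_{y,I}` is generated by the leading coefficients in `y` of all elements of `I`. -/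
lemma cIdeal_eq_span (hlt : IsCompatible κ j lt) (hG : IsGroebnerBasis lt G I) :
    cIdeal j G = Ideal.span {q | ∃ f ∈ I, ∃ d, (yExpand j f).natDegree ≤ d ∧
      q = (yExpand j f).coeff d} := by
  apply le_antisymm <;> rw [cIdeal, Ideal.span_le]
  · rintro _ ⟨g, hg, rfl⟩
    exact Ideal.subset_span ⟨g, hG.1 g hg, _, le_rfl, initialCoeff_eq j g⟩
  · rintro _ ⟨f, hf, d, hd, rfl⟩
    exact (hG.division hlt hf).1 d (natDegree_yExpand j f ▸ hd)

/-- The ideal `N_{y,I}` is generated by the elements of `I` not involving `y`. -/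
lemma nIdeal_eq_span (hlt : IsCompatible κ j lt) (hG : IsGroebnerBasis lt G I) :
    nIdeal j G = Ideal.span {f | f ∈ I ∧ (yExpand j f).natDegree = 0} := by
  apply le_antisymm <;> rw [nIdeal, Ideal.span_le]
  · rintro _ ⟨g, hg, hg0, rfl⟩
    rw [initialCoeff_eq_self hg0]
    exact Ideal.subset_span ⟨hG.1 g hg, (natDegree_yExpand j g).trans hg0⟩
  · rintro f ⟨hf, h0⟩
    exact (hG.division hlt hf).2 (natDegree_yExpand j f ▸ h0)

lemma nIdeal_le_cIdeal : nIdeal j G ≤ cIdeal j G := by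
  rw [nIdeal, cIdeal]
  exact Ideal.span_mono fun _ ⟨g, hg, _, h⟩ ↦ ⟨g, hg, h⟩

lemma isYExtended_nIdeal : IsYExtended j (nIdeal j G) := by
  rw [nIdeal]
  refine isYExtended_span ?_
  rintro _ ⟨g, -, -, rfl⟩
  rw [initialCoeff_eq]
  exact isYFree_coeff g _

lemma isYExtended_cIdeal : IsYExtended j (cIdeal j G) := by
  rw [cIdeal]
  refine isYExtended_span ?_
  rintro _ ⟨g, -, rfl⟩
  rw [initialCoeff_eq]
  exact isYFree_coeff g _

lemma isHomogeneousIdeal_nIdeal (hlt : IsCompatible κ j lt) (hG : IsGroebnerBasis lt G I)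
    (hI : IsHomogeneousIdeal I) : IsHomogeneousIdeal (nIdeal j G) := by
  rw [isHomogeneousIdeal_iff] at hI
  have h : nIdeal j G = Ideal.span {f | f ∈ nIdeal j G ∧ ∃ e, f.IsHomogeneous e} := by
    refine le_antisymm ?_ (Ideal.span_le.mpr fun f hf ↦ hf.1)
    nth_rw 1 [nIdeal_eq_span hlt hG]
    rw [Ideal.span_le]
    rintro f ⟨hf, h0⟩
    rw [← sum_homogeneousComponent f]
    refine Ideal.sum_mem _ fun e _ ↦
      Ideal.subset_span ⟨?_, e, homogeneousComponent_isHomogeneous _ _⟩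
    rw [nIdeal_eq_span hlt hG]
    refine Ideal.subset_span ⟨hI f hf e, ?_⟩
    have := natDegree_yExpand_homogeneousComponent_le (j := j) f e
    omega
  rw [h]
  exact isHomogeneousIdeal_span fun f hf ↦ hf.2

lemma isHomogeneousIdeal_cIdeal (hlt : IsCompatible κ j lt) (hG : IsGroebnerBasis lt G I)
    (hI : IsHomogeneousIdeal I) : IsHomogeneousIdeal (cIdeal j G) := by
  rw [isHomogeneousIdeal_iff] at hI
  have h : cIdeal j G = Ideal.span {f | f ∈ cIdeal j G ∧ ∃ e, f.IsHomogeneous e} := by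
    refine le_antisymm ?_ (Ideal.span_le.mpr fun f hf ↦ hf.1)
    nth_rw 1 [cIdeal_eq_span hlt hG]
    rw [Ideal.span_le]
    rintro _ ⟨f, hf, d, hd, rfl⟩
    rw [← sum_homogeneousComponent f, map_sum, Polynomial.finsetSum_coeff]
    refine Ideal.sum_mem _ fun e _ ↦ ?_
    by_cases hed : d ≤ e
    · obtain ⟨k, rfl⟩ := Nat.exists_eq_add_of_le hed
      refine Ideal.subset_span ⟨?_, k,
        coeff_yExpand_isHomogeneous (homogeneousComponent_isHomogeneous _ _)⟩
      rw [cIdeal_eq_span hlt hG]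
      exact Ideal.subset_span ⟨_, hI f hf _, d,
        (natDegree_yExpand_homogeneousComponent_le f _).trans hd, rfl⟩
    · rw [coeff_yExpand_eq_zero (homogeneousComponent_isHomogeneous _ _) (not_le.mp hed)]
      exact Ideal.zero_mem _
  rw [h]
  exact isHomogeneousIdeal_span fun f hf ↦ hf.2

/-- The ideal `in_y I` is graded by the degree in `y`, and its elements of the form `q y ^ d` with
`q` free of `y` are initial forms of elements of `I`. -/
lemma exists_coeff_eq_of_mem_initialIdeal {g : MvPolynomial (Fin n) κ} (hg : g ∈ initialIdeal j I)
    (d : ℕ) :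
    ∃ f ∈ I, (yExpand j f).natDegree ≤ d ∧ (yExpand j f).coeff d = (yExpand j g).coeff d := by
  induction hg using Submodule.span_induction generalizing d with
  | mem g hg =>
    obtain ⟨f, hf, rfl⟩ := hg
    rw [yExpand_initialForm, Polynomial.coeff_monomial]
    split_ifs with h
    · exact ⟨f, hf, h.le, by rw [h]⟩
    · exact ⟨0, I.zero_mem, by simp, by simp⟩
  | zero => exact ⟨0, I.zero_mem, by simp, by simp⟩
  | add g₁ g₂ _ _ h₁ h₂ =>
    obtain ⟨f₁, hf₁, hd₁, hc₁⟩ := h₁ d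
    obtain ⟨f₂, hf₂, hd₂, hc₂⟩ := h₂ d
    refine ⟨f₁ + f₂, I.add_mem hf₁ hf₂, ?_, ?_⟩
    · rw [map_add]
      exact Polynomial.natDegree_add_le_of_degree_le hd₁ hd₂
    · rw [map_add, map_add, Polynomial.coeff_add, Polynomial.coeff_add, hc₁, hc₂]
  | smul a g _ h =>
    choose F hF hd hc using h
    refine ⟨∑ p ∈ Finset.HasAntidiagonal.antidiagonal d,
      (yExpand j a).coeff p.1 * X j ^ p.1 * F p.2,
      I.sum_mem fun p _ ↦ I.mul_mem_left _ (hF _), ?_, ?_⟩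
    · rw [map_sum]
      refine Polynomial.natDegree_sum_le_of_forall_le _ _ fun p hp ↦ ?_
      rw [map_mul, map_mul, map_pow, yExpand_X_self, yExpand_coeff]
      refine Polynomial.natDegree_mul_le.trans ?_
      rw [← Finset.HasAntidiagonal.mem_antidiagonal.mp hp]
      gcongr
      · exact Polynomial.natDegree_C_mul_X_pow_le _ _
      · exact hd _
    · rw [map_sum, Polynomial.finsetSum_coeff, smul_eq_mul, map_mul, Polynomial.coeff_mul]
      refine Finset.sum_congr rfl fun p hp ↦ ?_
      rw [map_mul, map_mul, map_pow, yExpand_X_self, yExpand_coeff,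
        ← Finset.HasAntidiagonal.mem_antidiagonal.mp hp, mul_assoc, Polynomial.coeff_C_mul,
        add_comm p.1, Polynomial.coeff_X_pow_mul, hc]

/-- In a geometric vertex decomposition every element of `C_{y,I}` free of `y` is the leading
coefficient of an element of `I` of degree at most one in `y`. -/
lemma IsGeometricVertexDecomposition.exists_linear (h : IsGeometricVertexDecomposition j I G)
    {q : MvPolynomial (Fin n) κ} (hq : q ∈ cIdeal j G) (hqy : IsYFree j q) :
    ∃ f ∈ I, (yExpand j f).natDegree ≤ 1 ∧ (yExpand j f).coeff 1 = q := by
  have h1 : q * X j ∈ initialIdeal j I := by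
    rw [h]
    refine ⟨Ideal.mul_mem_right _ _ hq, Ideal.mul_mem_left _ _ ?_⟩
    exact Ideal.mem_sup_right (Ideal.mem_span_singleton_self _)
  obtain ⟨f, hf, hd, hc⟩ := exists_coeff_eq_of_mem_initialIdeal h1 1
  refine ⟨f, hf, hd, ?_⟩
  rw [hc, map_mul, hqy, yExpand_X_self]
  simp

end Groebner

/-! ### Minimal primes of a linear extension -/

section LinearExtension

variable {κ : Type u} [Field κ] {n : ℕ} {j : Fin n}

lemma IsYFree.add {f g : MvPolynomial (Fin n) κ} (hf : IsYFree j f) (hg : IsYFree j g) :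
    IsYFree j (f + g) := by
  rw [IsYFree, map_add, hf, hg, Polynomial.C_add]

lemma IsYFree.mul {f g : MvPolynomial (Fin n) κ} (hf : IsYFree j f) (hg : IsYFree j g) :
    IsYFree j (f * g) := by
  rw [IsYFree, map_mul, hf, hg, Polynomial.C_mul]

lemma IsYFree.pow {f : MvPolynomial (Fin n) κ} (hf : IsYFree j f) (k : ℕ) :
    IsYFree j (f ^ k) := by
  rw [IsYFree, map_pow, hf, Polynomial.C_pow]

lemma mem_of_forall_coeff_mem {J : Ideal (MvPolynomial (Fin n) κ)} {f : MvPolynomial (Fin n) κ}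
    (h : ∀ d, (yExpand j f).coeff d ∈ J) : f ∈ J := by
  rw [← eval_yExpand j f, Polynomial.eval_eq_sum_range]
  exact J.sum_mem fun d _ ↦ J.mul_mem_right _ (h d)

/-- The kernel of `R → (R ⧸ P)[Y]` is a prime ideal between `N` and `P`, hence equal to `P`. -/
lemma IsYExtended.of_mem_minimalPrimes {N P : Ideal (MvPolynomial (Fin n) κ)}
    (hN : IsYExtended j N) (hP : P ∈ N.minimalPrimes) : IsYExtended j P := by
  have hPp : P.IsPrime := hP.1.1
  let φ := (Polynomial.mapRingHom (Ideal.Quotient.mk P)).comp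
    (yExpand (κ := κ) j).toRingHom
  have hφ (f) : f ∈ RingHom.ker φ ↔ ∀ d, (yExpand j f).coeff d ∈ P := by
    rw [RingHom.mem_ker, Polynomial.ext_iff]
    refine forall_congr' fun d ↦ ?_
    simp [φ, Ideal.Quotient.eq_zero_iff_mem]
  have h := hP.2 (y := RingHom.ker φ)
    ⟨RingHom.ker_isPrime φ, fun f hf ↦ (hφ f).mpr fun d ↦ hP.1.2 (hN f hf d)⟩
    (fun f hf ↦ mem_of_forall_coeff_mem ((hφ f).mp hf))
  exact fun f hf ↦ (hφ f).mp (h hf)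

lemma exists_mul_pow_mem_of_mem_minimalPrimes {A : Type*} [CommRing A] {N P : Ideal A}
    (hP : P ∈ N.minimalPrimes) {x : A} (hx : x ∈ P) : ∃ s ∉ P, ∃ k, s * x ^ k ∈ N := by
  have hPp : P.IsPrime := hP.1.1
  have h := IsLocalization.AtPrime.radical_map_of_mem_minimalPrimes
    (A := Localization.AtPrime P) P N hP
  have hx' : algebraMap A (Localization.AtPrime P) x ∈
      (N.map (algebraMap A (Localization.AtPrime P))).radical := by
    rw [h]
    exact Ideal.mem_map_of_mem _ hx
  obtain ⟨k, hk⟩ := hx'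
  rw [← map_pow, IsLocalization.algebraMap_mem_map_algebraMap_iff P.primeCompl] at hk
  obtain ⟨s, hs, hsk⟩ := hk
  exact ⟨s, hs, k, hsk⟩

variable (j) in
/-- The configuration of ideals coming from a geometric vertex decomposition: `N` and `C` are
extended from the polynomial ring in the variables other than `y`, `N` is generated by the elements
of `I` free of `y`, and the leading coefficients in `y` of the elements of `I` lie in `C` and are
attained by elements of `I` of degree at most one in `y`. -/
structure IsLinearExtension (I C N : Ideal (MvPolynomial (Fin n) κ)) : Prop where
  le_left : N ≤ I
  le_right : N ≤ C
  isYExtended_base : IsYExtended j N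
  isYExtended_right : IsYExtended j C
  mem_of_isYFree : ∀ f ∈ I, IsYFree j f → f ∈ N
  coeff_mem : ∀ f ∈ I, ∀ d, (yExpand j f).natDegree ≤ d → (yExpand j f).coeff d ∈ C
  exists_linear : ∀ q ∈ C, IsYFree j q →
    ∃ f ∈ I, (yExpand j f).natDegree ≤ 1 ∧ (yExpand j f).coeff 1 = q

lemma isLinearExtension {lt : MonomialOrder.{0, v} (Fin n)}
    {G : Finset (MvPolynomial (Fin n) κ)} {I : Ideal (MvPolynomial (Fin n) κ)}
    (hlt : IsCompatible κ j lt) (hG : IsGroebnerBasis lt G I)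
    (h : IsGeometricVertexDecomposition j I G) :
    IsLinearExtension j I (cIdeal j G) (nIdeal j G) where
  le_left := by
    rw [nIdeal_eq_span hlt hG, Ideal.span_le]
    exact fun f hf ↦ hf.1
  le_right := nIdeal_le_cIdeal
  isYExtended_base := isYExtended_nIdeal
  isYExtended_right := isYExtended_cIdeal
  mem_of_isYFree f hf hfy := by
    rw [nIdeal_eq_span hlt hG]
    exact Ideal.subset_span ⟨hf, by rw [hfy, Polynomial.natDegree_C]⟩
  coeff_mem f hf d hd := by
    rw [cIdeal_eq_span hlt hG]
    exact Ideal.subset_span ⟨f, hf, d, hd, rfl⟩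
  exists_linear _ hq hqy := h.exists_linear hq hqy

namespace IsLinearExtension

variable {I C N : Ideal (MvPolynomial (Fin n) κ)}

/-- For `f = q y + r` and `g = q' y + r'`, the element is `q r' - q' r`, which is free of `y`. -/
lemma sub_mem (h : IsLinearExtension j I C N) {f g : MvPolynomial (Fin n) κ} (hf : f ∈ I)
    (hg : g ∈ I) (hf1 : (yExpand j f).natDegree ≤ 1) (hg1 : (yExpand j g).natDegree ≤ 1) :
    (yExpand j f).coeff 1 * g - (yExpand j g).coeff 1 * f ∈ N := by
  refine h.mem_of_isYFree _ (I.sub_mem (I.mul_mem_left _ hg) (I.mul_mem_left _ hf))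
    (isYFree_of_natDegree_eq_zero (Nat.lt_one_iff.mp (sub_natDegree_lt one_pos ?_ ?_ ?_)))
  · rw [map_mul, yExpand_coeff]
    exact (Polynomial.natDegree_C_mul_le _ _).trans hg1
  · rw [map_mul, yExpand_coeff]
    exact (Polynomial.natDegree_C_mul_le _ _).trans hf1
  · rw [map_mul, map_mul, yExpand_coeff, yExpand_coeff, Polynomial.coeff_C_mul,
      Polynomial.coeff_C_mul, mul_comm]

/-- `I` is generated by its elements of degree at most one in `y`: multiples of these by powers of
`y` cancel the leading terms in `y` of all other elements. -/
lemma left_eq_span (h : IsLinearExtension j I C N) :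
    I = Ideal.span {f | f ∈ I ∧ (yExpand j f).natDegree ≤ 1} := by
  refine le_antisymm (fun f hf ↦ ?_) (Ideal.span_le.mpr fun f hf ↦ hf.1)
  induction hd : (yExpand j f).natDegree using Nat.strong_induction_on generalizing f with
  | h d ih =>
    by_cases hd1 : d ≤ 1
    · exact Ideal.subset_span ⟨hf, hd.trans_le hd1⟩
    obtain ⟨g, hg, hg1, hgc⟩ := h.exists_linear _ (h.coeff_mem f hf d hd.le) (isYFree_coeff f d)
    obtain ⟨e, rfl⟩ : ∃ e, d = e + 1 := ⟨d - 1, by omega⟩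
    have hg' : X j ^ e * g ∈ I := I.mul_mem_left _ hg
    have hlt : (yExpand j (f - X j ^ e * g)).natDegree < e + 1 := by
      refine sub_natDegree_lt (Nat.succ_pos e) hd.le ?_ ?_
      · rw [map_mul, map_pow, yExpand_X_self]
        exact Polynomial.natDegree_mul_le_of_le (Polynomial.natDegree_X_pow_le e) hg1
      · rw [map_mul, map_pow, yExpand_X_self, add_comm e, Polynomial.coeff_X_pow_mul, hgc, add_comm]
    have h1 := ih _ hlt _ (I.sub_mem hf hg') rfl
    rw [← sub_add_cancel f (X j ^ e * g)]
    exact Ideal.add_mem _ h1 (Ideal.mul_mem_left _ _ (Ideal.subset_span ⟨hg, hg1⟩))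

lemma right_eq_span (h : IsLinearExtension j I C N) :
    C = Ideal.span {q | ∃ f ∈ I, (yExpand j f).natDegree ≤ 1 ∧ (yExpand j f).coeff 1 = q} := by
  refine le_antisymm (fun q hq ↦ mem_of_forall_coeff_mem (j := j) fun d ↦ ?_) (Ideal.span_le.mpr ?_)
  · exact Ideal.subset_span (h.exists_linear _ (h.isYExtended_right q hq d) (isYFree_coeff q d))
  · rintro _ ⟨f, hf, hf1, rfl⟩
    exact h.coeff_mem f hf 1 hf1

lemma right_le_of_left_le (h : IsLinearExtension j I C N) {P : Ideal (MvPolynomial (Fin n) κ)}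
    (hP : IsYExtended j P) (hIP : I ≤ P) : C ≤ P := by
  rw [h.right_eq_span, Ideal.span_le]
  rintro _ ⟨f, hf, -, rfl⟩
  exact hP f (hIP hf) 1

/-- If `P` contains `C` then, up to a factor outside `P`, the elements `q` of `C` are nilpotent
modulo `N`; for `q y + r ∈ I` the same then holds for `r`. -/
lemma left_le_of_right_le (h : IsLinearExtension j I C N) {P : Ideal (MvPolynomial (Fin n) κ)}
    (hP : P ∈ N.minimalPrimes) (hCP : C ≤ P) : I ≤ P := by
  have hPp : P.IsPrime := hP.1.1
  rw [h.left_eq_span, Ideal.span_le]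
  rintro f ⟨hf, hf1⟩
  set q := (yExpand j f).coeff 1 with hq
  set r := (yExpand j f).coeff 0 with hr
  have hfe : f = q * X j + r := eq_of_natDegree_le_one hf1
  have hqP : q ∈ P := hCP (h.coeff_mem f hf 1 hf1)
  have hrP : r ∈ P := by
    obtain ⟨s, hs, k, hk⟩ := exists_mul_pow_mem_of_mem_minimalPrimes hP hqP
    obtain ⟨d, hd⟩ : ∃ d, (yExpand j s).coeff d ∉ P := by
      by_contra! hcon
      exact hs (mem_of_forall_coeff_mem hcon)
    set t := (yExpand j s).coeff d
    have hqk : t * q ^ k ∈ N := by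
      have := h.isYExtended_base _ hk d
      rwa [map_mul, (isYFree_coeff f 1).pow k, Polynomial.coeff_mul_C] at this
    have hrk : t * r ^ k ∈ I := by
      obtain ⟨c, hc⟩ := sub_dvd_pow_sub_pow r (-(q * X j)) k
      have he : t * r ^ k = t * c * f + (-X j) ^ k * (t * q ^ k) := by
        rw [hfe]
        have h1 : (-(q * X j)) ^ k = (-X j) ^ k * q ^ k := by rw [← mul_pow]; ring
        rw [h1] at hc
        linear_combination t * hc
      rw [he]
      exact I.add_mem (I.mul_mem_left _ hf) (I.mul_mem_left _ (h.le_left hqk))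
    have hrN := h.mem_of_isYFree _ hrk ((isYFree_coeff s d).mul ((isYFree_coeff f 0).pow k))
    exact hPp.mem_of_pow_mem k ((hPp.mem_or_mem (hP.1.2 hrN)).resolve_left hd)
  rw [SetLike.mem_coe, hfe]
  exact P.add_mem (P.mul_mem_right _ hqP) hrP

/-- If the minimal prime `P` of `N` does not contain `C`, choose `f₀ = q y + r` in `I` with
`q ∉ P`. The prime `Q` is the kernel of the map `R → Frac (R ⧸ P)` sending `y` to `-r / q`. -/
lemma exists_mem_minimalPrimes (h : IsLinearExtension j I C N)
    {P : Ideal (MvPolynomial (Fin n) κ)} (hP : P ∈ N.minimalPrimes) (hCP : ¬ C ≤ P) :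
    ∃ Q ∈ I.minimalPrimes, P < Q ∧ (Q.map (Ideal.Quotient.mk P)).height ≤ 1 := by
  have hPp : P.IsPrime := hP.1.1
  have hPext := h.isYExtended_base.of_mem_minimalPrimes hP
  obtain ⟨f₀, hf₀, hf₀1, hqP⟩ : ∃ f₀ ∈ I, (yExpand j f₀).natDegree ≤ 1 ∧
      (yExpand j f₀).coeff 1 ∉ P := by
    by_contra! hcon
    apply hCP
    rw [h.right_eq_span, Ideal.span_le]
    rintro _ ⟨f, hf, hf1, rfl⟩
    exact hcon f hf hf1
  have hf₀P : f₀ ∉ P := fun hf ↦ hqP (hPext f₀ hf 1)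
  set q := (yExpand j f₀).coeff 1 with hq
  set r := (yExpand j f₀).coeff 0 with hr
  have hqy : IsYFree j q := isYFree_coeff f₀ 1
  have hry : IsYFree j r := isYFree_coeff f₀ 0
  have hfe : f₀ = q * X j + r := eq_of_natDegree_le_one hf₀1
  let K := FractionRing (MvPolynomial (Fin n) κ ⧸ P)
  let φ : MvPolynomial (Fin n) κ →+* K := (algebraMap _ K).comp (Ideal.Quotient.mk P)
  have hφ (f) : φ f = 0 ↔ f ∈ P := by
    simp [φ, K, Ideal.Quotient.eq_zero_iff_mem]
  let ψ : MvPolynomial (Fin n) κ →+* K :=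
    (Polynomial.eval₂RingHom φ (-φ r / φ q)).comp (yExpand (κ := κ) j).toRingHom
  have hψ (f) (hf : IsYFree j f) : ψ f = φ f := by
    have : yExpand j f = Polynomial.C f := hf
    simp [ψ, this]
  have hψy : ψ (X j) = -φ r / φ q := by simp [ψ]
  have hφq : φ q ≠ 0 := (hφ q).not.mpr hqP
  have hψf₀ : ψ f₀ = 0 := by
    rw [hfe, map_add, map_mul, hψ q hqy, hψ r hry, hψy,
      mul_comm, div_mul_cancel₀ _ hφq, neg_add_cancel]
  have hPψ (f) (hf : f ∈ P) : ψ f = 0 := by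
    simp only [ψ, RingHom.comp_apply, Polynomial.coe_eval₂RingHom]
    rw [Polynomial.eval₂_eq_sum_range]
    refine Finset.sum_eq_zero fun d _ ↦ ?_
    exact mul_eq_zero_of_left ((hφ _).mpr (hPext f hf d)) _
  have hIψ : I ≤ RingHom.ker ψ := by
    rw [h.left_eq_span, Ideal.span_le]
    rintro f ⟨hf, hf1⟩
    have h1 := hPψ _ (hP.1.2 (h.sub_mem hf₀ hf hf₀1 hf1))
    rw [map_sub, map_mul, map_mul, hψf₀, mul_zero, sub_zero, ← hq, hψ q hqy] at h1
    exact (mul_eq_zero.mp h1).resolve_left hφq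
  have hQp : (RingHom.ker ψ).IsPrime := RingHom.ker_isPrime ψ
  -- modulo `f₀`, a power of `q` clears `y` from any polynomial
  have hclear (g : MvPolynomial (Fin n) κ) :
      ∃ k s, IsYFree j s ∧ f₀ ∣ q ^ k * g - s := by
    induction g using MvPolynomial.induction_on with
    | C a => exact ⟨0, MvPolynomial.C a, by rw [IsYFree, yExpand, algHom_C]; rfl, by simp⟩
    | add g₁ g₂ h₁ h₂ =>
      obtain ⟨k₁, s₁, hs₁, c₁, hc₁⟩ := h₁
      obtain ⟨k₂, s₂, hs₂, c₂, hc₂⟩ := h₂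
      refine ⟨k₁ + k₂, q ^ k₂ * s₁ + q ^ k₁ * s₂,
        ((hqy.pow _).mul hs₁).add ((hqy.pow _).mul hs₂), q ^ k₂ * c₁ + q ^ k₁ * c₂, ?_⟩
      linear_combination q ^ k₂ * hc₁ + q ^ k₁ * hc₂
    | mul_X g i h₁ =>
      obtain ⟨k, s, hs, c, hc⟩ := h₁
      by_cases hi : i = j
      · subst hi
        have hs' : IsYFree i (-r * s) := by
          rw [IsYFree, map_mul, map_neg, hry, hs, Polynomial.C_mul, Polynomial.C_neg]
        refine ⟨k + 1, -r * s, hs', q * X i * c + s, ?_⟩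
        linear_combination q * X i * hc - s * hfe
      · refine ⟨k, s * X i, hs.mul (yExpand_X_of_ne j hi), c * X i, ?_⟩
        linear_combination X i * hc
  have hmin (Q₁ : Ideal (MvPolynomial (Fin n) κ)) (hQ₁ : Q₁.IsPrime) (hle : Q₁ ≤ RingHom.ker ψ)
      (hPQ₁ : P ≤ Q₁) (hfQ₁ : f₀ ∈ Q₁) : RingHom.ker ψ ≤ Q₁ := by
    intro g hg
    obtain ⟨k, s, hs, c, hc⟩ := hclear g
    have hs0 : φ s = 0 := by
      have := congrArg ψ hc
      rw [map_sub, map_mul, map_mul, hψf₀, (RingHom.mem_ker).mp hg, hψ s hs] at this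
      simpa using this
    have hsQ₁ : q ^ k * g ∈ Q₁ := by
      rw [← sub_add_cancel (q ^ k * g) s, hc]
      exact Q₁.add_mem (Q₁.mul_mem_right _ hfQ₁) (hPQ₁ ((hφ s).mp hs0))
    refine (hQ₁.mem_or_mem hsQ₁).resolve_left fun hqk ↦ hφq ?_
    rw [← hψ q hqy]
    exact hle (hQ₁.mem_of_pow_mem k hqk)
  have hPQ : P ≤ RingHom.ker ψ := fun f hf ↦ hPψ f hf
  refine ⟨RingHom.ker ψ, ⟨⟨hQp, hIψ⟩, fun Q₁ hQ₁ hle ↦ ?_⟩,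
    lt_of_le_of_ne hPQ fun heq ↦ hf₀P (heq ▸ hψf₀), ?_⟩
  · have hQ₁p : Q₁.IsPrime := hQ₁.1
    obtain ⟨P₁, hP₁, hP₁Q₁⟩ := Ideal.exists_minimalPrimes_le (h.le_left.trans hQ₁.2)
    have hP₁ext := h.isYExtended_base.of_mem_minimalPrimes hP₁
    have hP₁P : P₁ ≤ P := fun f hf ↦ mem_of_forall_coeff_mem fun d ↦ by
      rw [← hφ, ← hψ _ (isYFree_coeff f d)]
      exact hle (hP₁Q₁ (hP₁ext f hf d))
    exact hmin Q₁ hQ₁p hle ((hP.2 hP₁.1 hP₁P).trans hP₁Q₁) (hQ₁.2 hf₀)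
  · refine Ideal.map_height_le_one_of_mem_minimalPrimes (x := f₀) ⟨⟨hQp, ?_⟩, fun Q₁ hQ₁ hle ↦ ?_⟩
    · exact sup_le hPQ ((Ideal.span_singleton_le_iff_mem _).mpr hψf₀)
    · exact hmin Q₁ hQ₁.1 hle (le_sup_left.trans hQ₁.2)
        (hQ₁.2 (Ideal.mem_sup_right (Ideal.mem_span_singleton_self _)))

end IsLinearExtension

end LinearExtension

/-! ### The isomorphism `I/N ≅ [C/N](-1)` -/

section Isomorphism

variable {κ : Type u} [Field κ] {n : ℕ} {j : Fin n} {I C N : Ideal (MvPolynomial (Fin n) κ)}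

variable (j) in
/-- The graph of the isomorphism `I/N ≅ C/N` which maps the class of `q y + r` to the class of `q`,
as a relation between `f ∈ I` and `c ∈ C`: for all `q y + r ∈ I` the fractions `c / f` and
`q / (q y + r)` agree modulo `N`, in the form `q f ≡ c (q y + r)`. -/
structure IsLinked (I C N : Ideal (MvPolynomial (Fin n) κ)) (f c : MvPolynomial (Fin n) κ) :
    Prop where
  left_mem : f ∈ I
  right_mem : c ∈ C
  sub_mem : ∀ g ∈ I, (yExpand j g).natDegree ≤ 1 → (yExpand j g).coeff 1 * f - c * g ∈ N

namespace IsLinked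

lemma zero : IsLinked j I C N 0 0 := ⟨I.zero_mem, C.zero_mem, by simp⟩

lemma add {f f' c c' : MvPolynomial (Fin n) κ} (h : IsLinked j I C N f c)
    (h' : IsLinked j I C N f' c') : IsLinked j I C N (f + f') (c + c') where
  left_mem := I.add_mem h.left_mem h'.left_mem
  right_mem := C.add_mem h.right_mem h'.right_mem
  sub_mem g hg hg1 := by
    convert N.add_mem (h.sub_mem g hg hg1) (h'.sub_mem g hg hg1) using 1
    ring

lemma mul {f c : MvPolynomial (Fin n) κ} (h : IsLinked j I C N f c)
    (a : MvPolynomial (Fin n) κ) :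
    IsLinked j I C N (a * f) (a * c) where
  left_mem := I.mul_mem_left _ h.left_mem
  right_mem := C.mul_mem_left _ h.right_mem
  sub_mem g hg hg1 := by
    convert N.mul_mem_left a (h.sub_mem g hg hg1) using 1
    ring

lemma sub {f f' c c' : MvPolynomial (Fin n) κ} (h : IsLinked j I C N f c)
    (h' : IsLinked j I C N f' c') : IsLinked j I C N (f - f') (c - c') := by
  have := h.add (h'.mul (-1))
  simpa [sub_eq_add_neg] using this

end IsLinked

namespace IsLinearExtension

lemma isLinked_coeff (h : IsLinearExtension j I C N) {f : MvPolynomial (Fin n) κ} (hf : f ∈ I)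
    (hf1 : (yExpand j f).natDegree ≤ 1) : IsLinked j I C N f ((yExpand j f).coeff 1) :=
  ⟨hf, h.coeff_mem f hf 1 hf1, fun _ hg hg1 ↦ h.sub_mem hg hf hg1 hf1⟩

lemma exists_isLinked_left (h : IsLinearExtension j I C N) {f : MvPolynomial (Fin n) κ}
    (hf : f ∈ I) : ∃ c, IsLinked j I C N f c := by
  rw [h.left_eq_span] at hf
  induction hf using Submodule.span_induction with
  | mem f hf => exact ⟨_, h.isLinked_coeff hf.1 hf.2⟩
  | zero => exact ⟨0, .zero⟩
  | add f f' _ _ h₁ h₂ =>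
    obtain ⟨c, hc⟩ := h₁
    obtain ⟨c', hc'⟩ := h₂
    exact ⟨_, hc.add hc'⟩
  | smul a f _ h₁ =>
    obtain ⟨c, hc⟩ := h₁
    exact ⟨_, hc.mul a⟩

lemma exists_isLinked_right (h : IsLinearExtension j I C N) {c : MvPolynomial (Fin n) κ}
    (hc : c ∈ C) : ∃ f, IsLinked j I C N f c := by
  rw [h.right_eq_span] at hc
  induction hc using Submodule.span_induction with
  | mem c hc =>
    obtain ⟨f, hf, hf1, rfl⟩ := hc
    exact ⟨_, h.isLinked_coeff hf hf1⟩
  | zero => exact ⟨0, .zero⟩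
  | add c c' _ _ h₁ h₂ =>
    obtain ⟨f, hf⟩ := h₁
    obtain ⟨f', hf'⟩ := h₂
    exact ⟨_, hf.add hf'⟩
  | smul a c _ h₁ =>
    obtain ⟨f, hf⟩ := h₁
    exact ⟨_, hf.mul a⟩

end IsLinearExtension

/-- The condition `N : J = N`. As `R` is Noetherian, it says that `J` contains a nonzerodivisor
modulo `N`. -/
def IsColonTrivial (N J : Ideal (MvPolynomial (Fin n) κ)) : Prop :=
  ∀ f, (∀ g ∈ J, g * f ∈ N) → f ∈ N

namespace IsLinked

lemma left_mem_base (h : IsLinearExtension j I C N) (hC : IsColonTrivial N C)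
    {f c : MvPolynomial (Fin n) κ} (hfc : IsLinked j I C N f c) (hc : c ∈ N) : f ∈ N := by
  refine hC f fun g hg ↦ ?_
  have hle : C ≤ (Submodule.colon N {f} : Ideal (MvPolynomial (Fin n) κ)) := by
    rw [h.right_eq_span, Ideal.span_le]
    rintro _ ⟨g, hg, hg1, rfl⟩
    rw [SetLike.mem_coe, Submodule.mem_colon_singleton, smul_eq_mul,
      ← sub_add_cancel ((yExpand j g).coeff 1 * f) (c * g)]
    exact N.add_mem (hfc.sub_mem g hg hg1) (N.mul_mem_right _ hc)
  exact Submodule.mem_colon_singleton.mp (hle hg)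

lemma right_mem_base (h : IsLinearExtension j I C N) (hI : IsColonTrivial N I)
    {f c : MvPolynomial (Fin n) κ} (hfc : IsLinked j I C N f c) (hf : f ∈ N) : c ∈ N := by
  refine hI c fun g hg ↦ ?_
  have hle : I ≤ (Submodule.colon N {c} : Ideal (MvPolynomial (Fin n) κ)) := by
    nth_rw 1 [h.left_eq_span]
    rw [Ideal.span_le]
    rintro g ⟨hg, hg1⟩
    rw [SetLike.mem_coe, Submodule.mem_colon_singleton, smul_eq_mul, mul_comm,
      ← N.neg_mem_iff, ← sub_add_cancel (-(c * g)) (-((yExpand j g).coeff 1 * f))]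
    refine N.add_mem ?_ (N.neg_mem (N.mul_mem_left _ hf))
    convert hfc.sub_mem g hg hg1 using 1
    ring
  exact Submodule.mem_colon_singleton.mp (hle hg)

/-- The graph is graded, the second component being shifted by one: this is checked against the
homogeneous elements `q y + r` of `I`, where `q` has degree one less than `q y + r`. -/
lemma homogeneousComponent (hI : IsHomogeneousIdeal I) (hC : IsHomogeneousIdeal C)
    (hN : IsHomogeneousIdeal N) {f c : MvPolynomial (Fin n) κ} (h : IsLinked j I C N f c) (e : ℕ) :
    IsLinked j I C N (homogeneousComponent (e + 1) f) (homogeneousComponent e c) := by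
  rw [isHomogeneousIdeal_iff] at hI hC hN
  refine ⟨hI f h.left_mem _, hC c h.right_mem _, fun g hg hg1 ↦ ?_⟩
  rw [← sum_homogeneousComponent g, map_sum, Polynomial.finsetSum_coeff, Finset.sum_mul,
    Finset.mul_sum, ← Finset.sum_sub_distrib]
  refine N.sum_mem fun k _ ↦ ?_
  have hgk := homogeneousComponent_isHomogeneous k g
  have h1 := h.sub_mem _ (hI g hg k) ((natDegree_yExpand_homogeneousComponent_le g k).trans hg1)
  rcases k with _ | k
  · have h2 := hN _ h1 (e + 0)
    rw [coeff_yExpand_eq_zero hgk one_pos, zero_mul, zero_sub] at h2 ⊢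
    rw [map_neg, mul_comm c, add_comm, homogeneousComponent_mul_add hgk] at h2
    rwa [mul_comm]
  · have h2 := hN _ h1 (k + (e + 1))
    rw [add_comm k 1] at hgk
    have hq := coeff_yExpand_isHomogeneous (j := j) hgk
    rw [map_sub, add_comm 1 k] at *
    rw [homogeneousComponent_mul_add hq, show k + (e + 1) = (k + 1) + e by ring, mul_comm c,
      homogeneousComponent_mul_add hgk] at h2
    rwa [mul_comm (MvPolynomial.homogeneousComponent e c)]

/-- The degree zero part of `f` is linked to zero: `C` has nothing in degree `-1`. -/
lemma homogeneousComponent_zero (hI : IsHomogeneousIdeal I) (hN : IsHomogeneousIdeal N)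
    {f c : MvPolynomial (Fin n) κ} (h : IsLinked j I C N f c) :
    IsLinked j I C N (MvPolynomial.homogeneousComponent 0 f) 0 := by
  rw [isHomogeneousIdeal_iff] at hI hN
  refine ⟨hI f h.left_mem _, C.zero_mem, fun g hg hg1 ↦ ?_⟩
  rw [zero_mul, sub_zero]
  rw [← sum_homogeneousComponent g, map_sum, Polynomial.finsetSum_coeff, Finset.sum_mul]
  refine N.sum_mem fun k _ ↦ ?_
  have hgk := homogeneousComponent_isHomogeneous k g
  have h1 := h.sub_mem _ (hI g hg k) ((natDegree_yExpand_homogeneousComponent_le g k).trans hg1)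
  rcases k with _ | k
  · rw [coeff_yExpand_eq_zero hgk one_pos, zero_mul]
    exact N.zero_mem
  · have h2 := hN _ h1 (k + 0)
    have hgk' := hgk
    rw [add_comm k 1] at hgk'
    have hq := coeff_yExpand_isHomogeneous (j := j) hgk'
    rw [add_comm 1 k] at hq
    rw [map_sub, homogeneousComponent_mul_add hq, mul_comm c,
      homogeneousComponent_mul_eq_zero hgk _ (by omega), sub_zero] at h2
    exact h2

end IsLinked

lemma homogeneousComponent_of_isHomogeneous {f : MvPolynomial (Fin n) κ} {e : ℕ}
    (hf : f.IsHomogeneous e) : homogeneousComponent e f = f := by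
  rw [homogeneousComponent_of_mem hf, if_pos rfl]

lemma exists_mk_eq {N J : Ideal (MvPolynomial (Fin n) κ)} (x : quotIdeal N J) :
    ∃ f ∈ J, Ideal.Quotient.mk N f = x.1 :=
  (Ideal.mem_map_iff_of_surjective _ Ideal.Quotient.mk_surjective).mp x.2

/-- The graph of linked elements defines an isomorphism of graded modules. -/
lemma IsLinearExtension.gradedIso (h : IsLinearExtension j I C N) (hIN : IsColonTrivial N I)
    (hCN : IsColonTrivial N C) (hI : IsHomogeneousIdeal I) (hC : IsHomogeneousIdeal C)
    (hN : IsHomogeneousIdeal N) : GradedIso N I C 1 := by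
  choose F hFI hFx using fun x : quotIdeal N I ↦ exists_mk_eq x
  choose c hc using fun x ↦ h.exists_isLinked_left (hFI x)
  let φ (x : quotIdeal N I) : quotIdeal N C :=
    ⟨Ideal.Quotient.mk N (c x), Ideal.mem_map_of_mem _ (hc x).right_mem⟩
  have hφ (x) {f d} (hfd : IsLinked j I C N f d) (hfx : Ideal.Quotient.mk N f = x.1) :
      (φ x).1 = Ideal.Quotient.mk N d := by
    have h1 := (hc x).sub hfd
    refine Ideal.Quotient.eq.mpr (h1.right_mem_base h hIN ?_)
    rw [← Ideal.Quotient.eq, hFx, hfx]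
  let L : quotIdeal N I →ₗ[MvPolynomial (Fin n) κ ⧸ N] quotIdeal N C :=
    { toFun := φ
      map_add' := fun x y ↦ by
        refine Subtype.ext ?_
        rw [hφ (x + y) ((hc x).add (hc y)) (by rw [map_add, hFx, hFx]; rfl), map_add]
        rfl
      map_smul' := fun a x ↦ by
        obtain ⟨a, rfl⟩ := Ideal.Quotient.mk_surjective a
        refine Subtype.ext ?_
        rw [hφ _ ((hc x).mul a) (by rw [map_mul, hFx]; rfl), map_mul]
        rfl }
  have hinj : Function.Injective L := by
    rw [injective_iff_map_eq_zero]
    intro x hx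
    have h1 : Ideal.Quotient.mk N (c x) = 0 := congrArg Subtype.val hx
    rw [Ideal.Quotient.eq_zero_iff_mem] at h1
    refine Subtype.ext ?_
    rw [← hFx, Ideal.Quotient.eq_zero_iff_mem.mpr ((hc x).left_mem_base h hCN h1)]
    rfl
  have hsurj : Function.Surjective L := by
    intro z
    obtain ⟨d, hd, hdz⟩ := exists_mk_eq z
    obtain ⟨f, hf⟩ := h.exists_isLinked_right hd
    refine ⟨⟨Ideal.Quotient.mk N f, Ideal.mem_map_of_mem _ hf.left_mem⟩, Subtype.ext ?_⟩
    rw [← hdz]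
    exact hφ _ hf rfl
  refine ⟨LinearEquiv.ofBijective L ⟨hinj, hsurj⟩, fun d x ↦ ⟨?_, ?_⟩⟩
  · rintro (rfl | ⟨f, hf, e, rfl, hfe, hfx⟩)
    · exact Or.inl (map_zero _)
    obtain ⟨a, ha⟩ := h.exists_isLinked_left hf
    rcases e with _ | e
    -- an element of degree zero of `I` lies in `N`
    · left
      have h1 := ha.homogeneousComponent_zero hI hN
      rw [homogeneousComponent_of_isHomogeneous hfe] at h1
      have hx : x = 0 := Subtype.ext (by
        rw [← hfx, Ideal.Quotient.eq_zero_iff_mem.mpr (h1.left_mem_base h hCN N.zero_mem)]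
        rfl)
      rw [hx, map_zero]
    · right
      have h1 := ha.homogeneousComponent hI hC hN e
      rw [homogeneousComponent_of_isHomogeneous hfe] at h1
      exact ⟨_, h1.right_mem, e, by push_cast; ring, homogeneousComponent_isHomogeneous _ _,
        (hφ x h1 hfx).symm⟩
  · rintro (hx | ⟨a, ha, e, hed, hae, hax⟩)
    · exact Or.inl ((LinearEquiv.map_eq_zero_iff _).mp hx)
    obtain ⟨f, hf⟩ := h.exists_isLinked_right ha
    have h1 := hf.homogeneousComponent hI hC hN e
    rw [homogeneousComponent_of_isHomogeneous hae] at h1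
    refine Or.inr ⟨_, h1.left_mem, e + 1, by push_cast; omega,
      homogeneousComponent_isHomogeneous _ _, ?_⟩
    let x' : quotIdeal N I := ⟨Ideal.Quotient.mk N (MvPolynomial.homogeneousComponent (e + 1) f),
      Ideal.mem_map_of_mem _ h1.left_mem⟩
    have hxx' : x' = x := hinj (Subtype.ext ((hφ x' h1 rfl).trans hax))
    exact congrArg Subtype.val hxx'

end Isomorphism

/-! ### Heights of primes over unmixed and Cohen–Macaulay ideals -/

section Heights

variable {κ : Type u} [Field κ] {n : ℕ}

lemma exists_height_eq_ringKrullDim_eq (P : Ideal (MvPolynomial (Fin n) κ)) [P.IsPrime] :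
    ∃ a d : ℕ, P.height = a ∧ ringKrullDim (MvPolynomial (Fin n) κ ⧸ P) = d ∧ a + d = n := by
  have h := height_add_ringKrullDim_quotient κ P
  rw [MvPolynomial.ringKrullDim_of_isNoetherianRing, ringKrullDim_eq_zero_of_field, zero_add,
    Nat.card_fin] at h
  obtain ⟨a, ha⟩ := ENat.ne_top_iff_exists.mp (Ideal.height_ne_top_of_isPrime (I := P))
  obtain ⟨e, he⟩ := WithBot.ne_bot_iff_exists.mp (ne_bot_of_le_ne_bot (by simp)
    (ringKrullDim_nonneg_of_nontrivial (R := MvPolynomial (Fin n) κ ⧸ P)))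
  rw [← ha, ← he] at h
  replace h : (a : ℕ∞) + e = n := by exact_mod_cast h
  have hetop : e ≠ ⊤ := by
    rintro rfl
    simp at h
  obtain ⟨d, rfl⟩ := ENat.ne_top_iff_exists.mp hetop
  exact ⟨a, d, ha.symm, he.symm, by exact_mod_cast h⟩

lemma height_eq_add_height_map {P Q : Ideal (MvPolynomial (Fin n) κ)} [P.IsPrime] [Q.IsPrime]
    (h : P ≤ Q) : Q.height = P.height + (Q.map (Ideal.Quotient.mk P)).height := by
  obtain ⟨a, d, ha, hd, had⟩ := exists_height_eq_ringKrullDim_eq P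
  obtain ⟨b, e, hb, he, hbe⟩ := exists_height_eq_ringKrullDim_eq Q
  have hQ : (Q.map (Ideal.Quotient.mk P)).IsPrime := Ideal.isPrime_map_quotientMk_of_isPrime h
  have h1 := height_add_ringKrullDim_quotient κ (Q.map (Ideal.Quotient.mk P))
  rw [ringKrullDim_eq_of_ringEquiv (DoubleQuot.quotQuotEquivQuotOfLE h), hd, he] at h1
  have hle := height_add_height_map_le h
  rw [hb, ha] at hle
  have htop : (Q.map (Ideal.Quotient.mk P)).height ≠ ⊤ := Ideal.height_ne_top_of_isPrime
  obtain ⟨c, hc⟩ := ENat.ne_top_iff_exists.mp htop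
  rw [← hc] at h1 ⊢
  rw [ha, hb]
  have h2 : c + e = d := by exact_mod_cast h1
  exact_mod_cast (by omega : b = a + c)

lemma mem_associatedPrimes_of_mem_minimalPrimes {A : Type*} [CommRing A] [IsNoetherianRing A]
    {J P : Ideal A} (hP : P ∈ J.minimalPrimes) : P ∈ associatedPrimes A (A ⧸ J) := by
  rw [← Ideal.annihilator_quotient (I := J)] at hP
  exact Module.associatedPrimes.minimalPrimes_annihilator_subset_associatedPrimes A _ hP

lemma le_of_mem_associatedPrimes {A : Type*} [CommRing A]
    {J P : Ideal A} (hP : P ∈ associatedPrimes A (A ⧸ J)) : J ≤ P := by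
  have := IsAssociatedPrime.annihilator_le hP
  rwa [Submodule.annihilator_top, Ideal.annihilator_quotient] at this

lemma IsUnmixed.height_eq {J P : Ideal (MvPolynomial (Fin n) κ)} (hJ : IsUnmixed J)
    (hP : P ∈ associatedPrimes _ (MvPolynomial (Fin n) κ ⧸ J)) : P.height = J.height := by
  have key {Q : Ideal (MvPolynomial (Fin n) κ)}
      (hQ : Q ∈ associatedPrimes _ (MvPolynomial (Fin n) κ ⧸ J)) : P.height = Q.height := by
    have hPp : P.IsPrime := hP.1
    have hQp : Q.IsPrime := hQ.1
    obtain ⟨a, d, ha, hd, had⟩ := exists_height_eq_ringKrullDim_eq P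
    obtain ⟨b, e, hb, he, hbe⟩ := exists_height_eq_ringKrullDim_eq Q
    have h : (d : WithBot ℕ∞) = e := by rw [← hd, ← he, hJ P hP, hJ Q hQ]
    have h' : d = e := by exact_mod_cast h
    rw [ha, hb]
    exact_mod_cast (by omega : a = b)
  refine le_antisymm ?_ ?_
  · rw [Ideal.height_eq_inf_minimalPrimes J]
    exact le_iInf₂ fun Q hQ ↦ (key (mem_associatedPrimes_of_mem_minimalPrimes hQ)).le
  · exact Ideal.height_mono (le_of_mem_associatedPrimes hP)

lemma mem_irrelevantIdeal_iff {f : MvPolynomial (Fin n) κ} :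
    f ∈ irrelevantIdeal κ n ↔ f.coeff 0 = 0 := by
  have h := mem_pow_idealOfVars_iff' 1 f
  rw [pow_one] at h
  refine h.trans ⟨fun h ↦ h 0 (by simp), fun h x hx ↦ ?_⟩
  rwa [(Finsupp.degree_eq_zero_iff x).mp (Nat.lt_one_iff.mp hx)]

instance isMaximal_irrelevantIdeal : (irrelevantIdeal κ n).IsMaximal := by
  have h : irrelevantIdeal κ n = RingHom.ker (constantCoeff (R := κ) (σ := Fin n)) := by
    ext f
    rw [mem_irrelevantIdeal_iff, RingHom.mem_ker, constantCoeff_eq]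
  rw [h]
  exact RingHom.ker_isMaximal_of_surjective _ fun c ↦ ⟨C c, constantCoeff_C _ c⟩

lemma le_irrelevantIdeal {J : Ideal (MvPolynomial (Fin n) κ)} (hJ : IsHomogeneousIdeal J)
    (hJt : J ≠ ⊤) : J ≤ irrelevantIdeal κ n := by
  intro f hf
  rw [mem_irrelevantIdeal_iff]
  by_contra h0
  have h := isHomogeneousIdeal_iff.mp hJ f hf 0
  rw [homogeneousComponent_zero] at h
  exact hJt (Ideal.eq_top_of_isUnit_mem _ h ((isUnit_iff_ne_zero.mpr h0).map C))

section

attribute [local instance] MvPolynomial.gradedAlgebra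

lemma isHomogeneousIdeal_of_mem_minimalPrimes {J P : Ideal (MvPolynomial (Fin n) κ)}
    (hJ : IsHomogeneousIdeal J) (hP : P ∈ J.minimalPrimes) : IsHomogeneousIdeal P := by
  have h1 : (Ideal.homogeneousCore (homogeneousSubmodule (Fin n) κ) P).toIdeal.IsPrime :=
    Ideal.IsPrime.homogeneousCore hP.1.1
  have h2 := Ideal.toIdeal_homogeneousCore_le (homogeneousSubmodule (Fin n) κ) P
  have h3 : J ≤ (Ideal.homogeneousCore (homogeneousSubmodule (Fin n) κ) P).toIdeal := by
    rw [← Ideal.IsHomogeneous.toIdeal_homogeneousCore_eq_self hJ]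
    exact Ideal.homogeneousCore_mono _ hP.1.2
  have h4 := le_antisymm h2 (hP.2 ⟨h1, h3⟩ h2)
  rw [IsHomogeneousIdeal, ← h4]
  exact (Ideal.homogeneousCore (homogeneousSubmodule (Fin n) κ) P).isHomogeneous

end

lemma le_irrelevantIdeal_of_mem_minimalPrimes {J P : Ideal (MvPolynomial (Fin n) κ)}
    (hJ : IsHomogeneousIdeal J) (hP : P ∈ J.minimalPrimes) : P ≤ irrelevantIdeal κ n :=
  le_irrelevantIdeal (isHomogeneousIdeal_of_mem_minimalPrimes hJ hP) hP.1.1.ne_top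

lemma map_mk_mem_minimalPrimes {A : Type*} [CommRing A] {N P : Ideal A}
    (hP : P ∈ N.minimalPrimes) : P.map (Ideal.Quotient.mk N) ∈ minimalPrimes (A ⧸ N) := by
  rw [Ideal.minimalPrimes_eq_comap] at hP
  obtain ⟨p, hp, rfl⟩ := hP
  rwa [Ideal.map_comap_of_surjective _ Ideal.Quotient.mk_surjective]

/-- The primes `Q/N` of a Cohen–Macaulay ring have the same height as `Q/P`, for any minimal prime
`P ≤ Q` of `N`. -/
lemma IsCohenMacaulayIdeal.height_eq_add {N P Q : Ideal (MvPolynomial (Fin n) κ)}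
    (hN : IsCohenMacaulayIdeal N) (hP : P ∈ N.minimalPrimes) [Q.IsPrime] (h : P ≤ Q) :
    Q.height = P.height + (Q.map (Ideal.Quotient.mk N)).height := by
  have hPp : P.IsPrime := hP.1.1
  have hPN := hP.1.2
  have hp := map_mk_mem_minimalPrimes hP
  have hpa : P.map (Ideal.Quotient.mk N) ∈ associatedPrimes (MvPolynomial (Fin n) κ ⧸ N)
      (MvPolynomial (Fin n) κ ⧸ N) := by
    refine Module.associatedPrimes.minimalPrimes_annihilator_subset_associatedPrimes _ _ ?_
    rwa [Module.annihilator_eq_bot.mpr inferInstance]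
  have hpp : (P.map (Ideal.Quotient.mk N)).IsPrime := hp.1.1
  have hq : (Q.map (Ideal.Quotient.mk N)).IsPrime :=
    Ideal.isPrime_map_quotientMk_of_isPrime (hPN.trans h)
  have hle := IsCohenMacaulayRing.height_le hN hpa (Ideal.map_mono (f := Ideal.Quotient.mk N) h)
  have hge := le_trans le_add_self (height_add_height_map_le
    (Ideal.map_mono (f := Ideal.Quotient.mk N) h))
  have heq : (Q.map (Ideal.Quotient.mk P)).height =
      ((Q.map (Ideal.Quotient.mk N)).map
        (Ideal.Quotient.mk (P.map (Ideal.Quotient.mk N)))).height := by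
    rw [← RingEquiv.height_map (DoubleQuot.quotQuotEquivQuotOfLE hPN)]
    congr 1
    change _ = Ideal.map (DoubleQuot.quotQuotEquivQuotOfLE hPN).toRingHom _
    rw [Ideal.map_map, Ideal.map_map]
    rfl
  rw [height_eq_add_height_map h, heq, le_antisymm hle hge]

/-- All maximal chains of primes from `P` to the irrelevant ideal `m` have length `ht (m/N)`, so that
`ht P = ht m - ht (m/N)` does not depend on `P`. -/
lemma IsCohenMacaulayIdeal.height_eq_of_isHomogeneousIdeal {N P : Ideal (MvPolynomial (Fin n) κ)}
    (hN : IsCohenMacaulayIdeal N) (hNh : IsHomogeneousIdeal N) (hP : P ∈ N.minimalPrimes) :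
    P.height = N.height := by
  refine le_antisymm ?_ (Ideal.height_mono hP.1.2)
  rw [Ideal.height_eq_inf_minimalPrimes N]
  refine le_iInf₂ fun Q hQ ↦ ?_
  have h1 := hN.height_eq_add hP (le_irrelevantIdeal_of_mem_minimalPrimes hNh hP)
  have h2 := hN.height_eq_add hQ (le_irrelevantIdeal_of_mem_minimalPrimes hNh hQ)
  rw [h2] at h1
  have htop : ((irrelevantIdeal κ n).map (Ideal.Quotient.mk N)).height ≠ ⊤ := by
    intro h
    rw [h, add_top] at h2
    exact Ideal.height_ne_top_of_isPrime h2
  exact (ENat.add_left_injective_of_ne_top htop h1).ge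

/-- The associated primes of `R/N` are minimal, so an ideal contained in none of the minimal primes
of `N` contains a nonzerodivisor modulo `N`. -/
lemma IsCohenMacaulayIdeal.isColonTrivial {N J : Ideal (MvPolynomial (Fin n) κ)}
    (hN : IsCohenMacaulayIdeal N) (hJ : ∀ P ∈ N.minimalPrimes, ¬ J ≤ P) : IsColonTrivial N J := by
  intro f hf
  by_contra hfN
  have hf0 : Ideal.Quotient.mk N f ≠ 0 := by rwa [Ne, Ideal.Quotient.eq_zero_iff_mem]
  obtain ⟨p, hp, hle⟩ := exists_le_isAssociatedPrime_of_isNoetherianRing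
    (MvPolynomial (Fin n) κ ⧸ N) _ hf0
  have hpm := IsCohenMacaulayRing.mem_minimalPrimes hN hp
  refine hJ (p.comap (Ideal.Quotient.mk N)) ?_ fun g hg ↦ hle ?_
  · rw [Ideal.minimalPrimes_eq_comap]
    exact ⟨p, hpm, rfl⟩
  · rw [Submodule.mem_colon_singleton, smul_eq_mul, ← map_mul, Submodule.mem_bot,
      Ideal.Quotient.eq_zero_iff_mem]
    exact hf g hg

end Heights

/-! ### Transfer of associated primes from `R/C` to `R/I` -/

section Transfer

variable {κ : Type u} [Field κ] {n : ℕ} {j : Fin n} {I C N : Ideal (MvPolynomial (Fin n) κ)}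

lemma IsCohenMacaulayIdeal.exists_regular_pair (hN : IsCohenMacaulayIdeal N)
    {P : Ideal (MvPolynomial (Fin n) κ)} [hPp : P.IsPrime] (hNP : N ≤ P)
    (hP : 2 ≤ (P.map (Ideal.Quotient.mk N)).height) :
    ∃ a ∈ P, ∃ b ∈ P, (∀ x, a * x ∈ N → ∃ t ∉ P, t * x ∈ N) ∧
      ∀ x y, b * x - a * y ∈ N → ∃ t ∉ P, ∃ e, t * x - a * e ∈ N := by
  have hq : (P.map (Ideal.Quotient.mk N)).IsPrime := Ideal.isPrime_map_quotientMk_of_isPrime hNP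
  have hmem (x) : Ideal.Quotient.mk N x ∈ P.map (Ideal.Quotient.mk N) ↔ x ∈ P := by
    rw [← Ideal.mem_comap, Ideal.comap_map_of_surjective' _ Ideal.Quotient.mk_surjective,
      Ideal.mk_ker, sup_eq_left.mpr hNP]
  obtain ⟨a, ha, b, hb, h1, h2⟩ := IsCohenMacaulayRing.exists_regular_pair hN hP
  obtain ⟨a, rfl⟩ := Ideal.Quotient.mk_surjective a
  obtain ⟨b, rfl⟩ := Ideal.Quotient.mk_surjective b
  refine ⟨a, (hmem a).mp ha, b, (hmem b).mp hb, fun x hx ↦ ?_, fun x y hxy ↦ ?_⟩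
  · obtain ⟨t, ht, htx⟩ := h1 (Ideal.Quotient.mk N x)
      (by rwa [← map_mul, Ideal.Quotient.eq_zero_iff_mem])
    obtain ⟨t, rfl⟩ := Ideal.Quotient.mk_surjective t
    exact ⟨t, (hmem t).not.mp ht, by rwa [← map_mul, Ideal.Quotient.eq_zero_iff_mem] at htx⟩
  · obtain ⟨t, ht, e, hte⟩ := h2 (Ideal.Quotient.mk N x) (Ideal.Quotient.mk N y)
      (by rwa [← map_mul, ← map_mul, Ideal.Quotient.eq])
    obtain ⟨t, rfl⟩ := Ideal.Quotient.mk_surjective t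
    obtain ⟨e, rfl⟩ := Ideal.Quotient.mk_surjective e
    exact ⟨t, (hmem t).not.mp ht, e, by rwa [← map_mul, ← map_mul, Ideal.Quotient.eq] at hte⟩

lemma mem_bot_colon_mk_iff {A : Type*} [CommRing A] {J : Ideal A} {z g : A} :
    g ∈ (⊥ : Submodule A (A ⧸ J)).colon {Ideal.Quotient.mk J z} ↔ g * z ∈ J := by
  rw [Submodule.mem_colon_singleton, Submodule.mem_bot, ← Ideal.Quotient.eq_zero_iff_mem]
  rfl

/-- Up to a common factor outside the finitely generated prime `P`, the annihilator of the class of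
`e` is `P`. -/
lemma exists_forall_mul_mem {A : Type*} [CommRing A] [IsNoetherianRing A] {P J : Ideal A}
    [hP : P.IsPrime] {e : A} (h : ∀ p ∈ P, ∃ s ∉ P, s * p * e ∈ J) :
    ∃ s ∉ P, ∀ p ∈ P, s * p * e ∈ J := by
  classical
  obtain ⟨S, hS⟩ := IsNoetherian.noetherian P
  have hSP (p) (hp : p ∈ S) : p ∈ P := hS ▸ Ideal.subset_span hp
  choose! s hs hse using h
  refine ⟨∏ p ∈ S, s p, fun hmem ↦ ?_, fun p hp ↦ ?_⟩
  · obtain ⟨p, hp, hsp⟩ := (hP.prod_mem_iff).mp hmem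
    exact hs p (hSP p hp) hsp
  · rw [← hS] at hp
    induction hp using Submodule.span_induction with
    | mem p hp =>
      rw [← Finset.mul_prod_erase S s hp]
      convert J.mul_mem_left (∏ x ∈ S.erase p, s x) (hse p (hSP p hp)) using 1
      ring
    | zero => simp
    | add p p' _ _ h₁ h₂ => simpa only [mul_add, add_mul] using J.add_mem h₁ h₂
    | smul a p _ h₁ =>
      convert J.mul_mem_left a h₁ using 1
      rw [smul_eq_mul]
      ring

/-- The link between `I` and `C` turns `P = C : c₀` into a system of elements `f_p ∈ I`, linked to
`p c₀` for `p ∈ P`. As `R/N` has depth at least two at `P`, such a system is locally of the form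
`f_p = p e`, and then `P` is locally `I : e`. -/
lemma IsLinearExtension.mem_associatedPrimes (h : IsLinearExtension j I C N)
    (hI : IsColonTrivial N I) (hC : IsColonTrivial N C) (hN : IsCohenMacaulayIdeal N)
    {P : Ideal (MvPolynomial (Fin n) κ)}
    (hP : P ∈ associatedPrimes _ (MvPolynomial (Fin n) κ ⧸ C))
    (hht : 2 ≤ (P.map (Ideal.Quotient.mk N)).height) :
    P ∈ associatedPrimes _ (MvPolynomial (Fin n) κ ⧸ I) := by
  have hCP := le_of_mem_associatedPrimes hP
  obtain ⟨hPp, x, hx⟩ := isAssociatedPrime_iff.mp hP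
  obtain ⟨c₀, rfl⟩ := Ideal.Quotient.mk_surjective x
  have hmem (g) : g ∈ P ↔ g * c₀ ∈ C := by rw [hx, mem_bot_colon_mk_iff]
  obtain ⟨a, ha, b, hb, hreg₁, hreg₂⟩ := hN.exists_regular_pair (h.le_right.trans hCP) hht
  obtain ⟨fa, hfa⟩ := h.exists_isLinked_right ((hmem a).mp ha)
  obtain ⟨fb, hfb⟩ := h.exists_isLinked_right ((hmem b).mp hb)
  obtain ⟨t, ht, e, hte⟩ := hreg₂ fa fb <|
    ((hfa.mul b).sub (hfb.mul a)).left_mem_base h hC (by convert N.zero_mem; ring)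
  have key (p) (hp : p ∈ P) : ∃ s ∉ P, s * p * e ∈ I := by
    obtain ⟨fp, hfp⟩ := h.exists_isLinked_right ((hmem p).mp hp)
    have h1 : a * fp - p * fa ∈ N :=
      ((hfp.mul a).sub (hfa.mul p)).left_mem_base h hC (by convert N.zero_mem; ring)
    obtain ⟨s, hs, hs'⟩ := hreg₁ (t * fp - p * e) (by
      convert N.add_mem (N.mul_mem_left t h1) (N.mul_mem_left p hte) using 1
      ring)
    refine ⟨s, hs, ?_⟩
    convert I.sub_mem (I.mul_mem_left (s * t) hfp.left_mem) (h.le_left hs') using 1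
    ring
  obtain ⟨s, hs, hse⟩ := exists_forall_mul_mem key
  refine isAssociatedPrime_iff.mpr ⟨hPp, Ideal.Quotient.mk I (s * e), ?_⟩
  ext u
  rw [mem_bot_colon_mk_iff]
  refine ⟨fun hu ↦ ?_, fun hu ↦ ?_⟩
  · convert hse u hu using 1
    ring
  · obtain ⟨c, hc⟩ := h.exists_isLinked_left hu
    have h1 : a * (c - u * s * t * c₀) ∈ N := by
      convert ((hc.mul a).sub (hfa.mul (u * s * t))).right_mem_base h hI ?_ using 1
      · ring
      · convert N.mul_mem_left (-(u * s)) hte using 1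
        ring
    obtain ⟨s', hs', h2⟩ := hreg₁ _ h1
    have h3 : s' * (u * s * t) ∈ P := by
      rw [hmem]
      convert C.sub_mem (C.mul_mem_left s' hc.right_mem) (h.le_right h2) using 1
      ring
    by_contra huP
    exact (hPp.mul_notMem hs' (hPp.mul_notMem (hPp.mul_notMem huP hs) ht)) h3

end Transfer

/-! ### Heights of `N`, `I` and `C`, and saturation -/

section Main

variable {κ : Type u} [Field κ] {n : ℕ} {j : Fin n} {I C N : Ideal (MvPolynomial (Fin n) κ)}

namespace IsLinearExtension

lemma left_ne_top (h : IsLinearExtension j I C N) (hC : C ≠ ⊤) : I ≠ ⊤ := by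
  rw [Ne, Ideal.eq_top_iff_one] at hC ⊢
  exact fun h1 ↦ hC (h.le_right (h.mem_of_isYFree 1 h1 (by rw [IsYFree, map_one, map_one])))

/-- If one minimal prime of `N` contained `C` it would be a minimal prime of `I`, of height `ht N`.
By unmixedness of `I` no minimal prime of `I` could then contain strictly a minimal prime of `N`,
so that all minimal primes of `N` would contain `C`. -/
lemma not_right_le (h : IsLinearExtension j I C N) (hN : IsCohenMacaulayIdeal N)
    (hNh : IsHomogeneousIdeal N) (hI : IsUnmixed I) (hrad : C.radical ≠ N.radical)
    {P : Ideal (MvPolynomial (Fin n) κ)} (hP : P ∈ N.minimalPrimes) : ¬ C ≤ P := by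
  intro hCP
  refine hrad (le_antisymm ?_ (Ideal.radical_mono h.le_right))
  have hIP : P ∈ I.minimalPrimes :=
    ⟨⟨hP.1.1, h.left_le_of_right_le hP hCP⟩, fun Q hQ hQP ↦ hP.2 ⟨hQ.1, h.le_left.trans hQ.2⟩ hQP⟩
  have hIN : I.height = N.height := by
    rw [← hN.height_eq_of_isHomogeneousIdeal hNh hP,
      hI.height_eq (mem_associatedPrimes_of_mem_minimalPrimes hIP)]
  rw [← Ideal.sInf_minimalPrimes (I := N)]
  refine le_sInf fun P' hP' ↦ hP'.1.1.radical_le_iff.mpr ?_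
  by_contra hCP'
  obtain ⟨Q, hQ, hlt, -⟩ := h.exists_mem_minimalPrimes hP' hCP'
  have hP'p : P'.IsPrime := hP'.1.1
  have hQp : Q.IsPrime := hQ.1.1
  refine (Ideal.height_strict_mono_of_isPrime hlt).ne ?_
  rw [hN.height_eq_of_isHomogeneousIdeal hNh hP', ← hIN,
    hI.height_eq (mem_associatedPrimes_of_mem_minimalPrimes hQ)]

lemma height_left_eq (h : IsLinearExtension j I C N) (hN : IsCohenMacaulayIdeal N)
    (hNh : IsHomogeneousIdeal N) (hI : IsUnmixed I) (hCt : C ≠ ⊤)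
    (hNC : ∀ P ∈ N.minimalPrimes, ¬ C ≤ P) : N.height + 1 = I.height := by
  obtain ⟨P, hP⟩ :=
    Ideal.nonempty_minimalPrimes fun hNt ↦ hCt (top_le_iff.mp (hNt ▸ h.le_right))
  obtain ⟨Q, hQ, hlt, hht⟩ := h.exists_mem_minimalPrimes hP (hNC P hP)
  have hPp : P.IsPrime := hP.1.1
  have hQp : Q.IsPrime := hQ.1.1
  rw [← hI.height_eq (mem_associatedPrimes_of_mem_minimalPrimes hQ),
    ← hN.height_eq_of_isHomogeneousIdeal hNh hP]
  refine le_antisymm (Ideal.height_add_one_le_of_lt_of_isPrime hlt) ?_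
  rw [height_eq_add_height_map hlt.le]
  gcongr

/-- A minimal prime `Q` of `C` is either associated to `R/I` or has height at most one over `N`. -/
lemma height_right_eq (h : IsLinearExtension j I C N) (hN : IsCohenMacaulayIdeal N)
    (hNh : IsHomogeneousIdeal N) (hI : IsUnmixed I) (hC : IsUnmixed C) (hCt : C ≠ ⊤)
    (hNI : ∀ P ∈ N.minimalPrimes, ¬ I ≤ P) (hNC : ∀ P ∈ N.minimalPrimes, ¬ C ≤ P) :
    I.height = C.height := by
  have hIht := h.height_left_eq hN hNh hI hCt hNC
  obtain ⟨Q, hQ⟩ := Ideal.nonempty_minimalPrimes hCt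
  have hQa := mem_associatedPrimes_of_mem_minimalPrimes hQ
  have hQp : Q.IsPrime := hQ.1.1
  rw [← hC.height_eq hQa]
  by_cases hht : 2 ≤ (Q.map (Ideal.Quotient.mk N)).height
  · rw [hI.height_eq (h.mem_associatedPrimes (hN.isColonTrivial hNI) (hN.isColonTrivial hNC) hN
      hQa hht)]
  obtain ⟨P, hP, hPQ⟩ := Ideal.exists_minimalPrimes_le (h.le_right.trans hQ.1.2)
  have hPp : P.IsPrime := hP.1.1
  have hlt : P < Q := lt_of_le_of_ne hPQ fun heq ↦ hNC P hP (heq ▸ hQ.1.2)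
  rw [← hIht, ← hN.height_eq_of_isHomogeneousIdeal hNh hP]
  refine le_antisymm (Ideal.height_add_one_le_of_lt_of_isPrime hlt) ?_
  rw [hN.height_eq_add hP hPQ]
  gcongr
  exact Order.le_of_lt_add_one (by rw [one_add_one_eq_two]; exact not_le.mp hht)

end IsLinearExtension

/-- An element violating saturation makes the irrelevant ideal an associated prime. -/
lemma irrelevantIdeal_mem_associatedPrimes {J : Ideal (MvPolynomial (Fin n) κ)}
    (hJ : ¬ IsSaturated J) :
    irrelevantIdeal κ n ∈ associatedPrimes _ (MvPolynomial (Fin n) κ ⧸ J) := by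
  rw [IsSaturated] at hJ
  push Not at hJ
  obtain ⟨f, k, hf, hfJ⟩ := hJ
  have hf0 : Ideal.Quotient.mk J f ≠ 0 := by rwa [Ne, Ideal.Quotient.eq_zero_iff_mem]
  obtain ⟨P, hP, hle⟩ := exists_le_isAssociatedPrime_of_isNoetherianRing
    (MvPolynomial (Fin n) κ) _ hf0
  have hPp : P.IsPrime := hP.1
  have hmP : irrelevantIdeal κ n ≤ P := by
    exact hPp.le_of_pow_le (n := k) fun g hg ↦ hle (mem_bot_colon_mk_iff.mpr (hf g hg))
  rwa [isMaximal_irrelevantIdeal.eq_of_le hPp.ne_top hmP]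

/-- A proper homogeneous saturated ideal `I` has smaller height than the irrelevant ideal `m`;
otherwise `m` would be its only minimal prime, and a power of `m` would lie in `I`. -/
lemma height_ne_height_irrelevantIdeal (hIh : IsHomogeneousIdeal I) (hI : IsSaturated I)
    (hIt : I ≠ ⊤) : I.height ≠ (irrelevantIdeal κ n).height := by
  intro heq
  have hrad : irrelevantIdeal κ n ≤ I.radical := by
    rw [← Ideal.sInf_minimalPrimes]
    refine le_sInf fun Q hQ ↦ ?_
    have hQp : Q.IsPrime := hQ.1.1
    rcases (le_irrelevantIdeal_of_mem_minimalPrimes hIh hQ).eq_or_lt with hQm | hlt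
    · exact hQm.ge
    · exact absurd (Ideal.height_strict_mono_of_isPrime hlt)
        (not_lt.mpr (heq ▸ Ideal.height_mono hQ.1.2))
  obtain ⟨k, hk⟩ := Ideal.exists_pow_le_of_le_radical_of_fg hrad (IsNoetherian.noetherian _)
  refine hIt ((Ideal.eq_top_iff_one I).mpr (hI 1 k fun g hg ↦ ?_))
  rw [mul_one]
  exact hk hg

end Main

end GVD

theorem mainTheorem2 {κ : Type u} [Field κ] [Infinite κ] {n : ℕ} (j : Fin n)
    (I : Ideal (MvPolynomial (Fin n) κ))
    (lt : MonomialOrder.{0, v} (Fin n)) (hlt : GVD.IsCompatible κ j lt)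
    (G : Finset (MvPolynomial (Fin n) κ)) (hG : GVD.IsGroebnerBasis lt G I)
    (hI_hom : GVD.IsHomogeneousIdeal I) (hI_sat : GVD.IsSaturated I) (hI_unm : GVD.IsUnmixed I)
    (hgvd : GVD.IsGeometricVertexDecomposition j I G) (hnd : ¬ GVD.IsDegenerate j G)
    (hN_cm : GVD.IsCohenMacaulayIdeal (GVD.nIdeal j G)) (hN_g0 : GVD.IsGZeroIdeal (GVD.nIdeal j G))
    (hC_unm : GVD.IsUnmixed (GVD.cIdeal j G)) :
    GVD.IsElementaryGBiliaison I (GVD.cIdeal j G) 1 := by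
  obtain ⟨hrad, hC⟩ := not_or.mp hnd
  have h := GVD.isLinearExtension hlt hG hgvd
  have hN_hom := GVD.isHomogeneousIdeal_nIdeal hlt hG hI_hom
  have hC_hom := GVD.isHomogeneousIdeal_cIdeal hlt hG hI_hom
  have hNC (P) (hP : P ∈ (GVD.nIdeal j G).minimalPrimes) : ¬ GVD.cIdeal j G ≤ P :=
    h.not_right_le hN_cm hN_hom hI_unm hrad hP
  have hNI (P) (hP : P ∈ (GVD.nIdeal j G).minimalPrimes) : ¬ I ≤ P := fun hIP ↦
    hNC P hP (h.right_le_of_left_le (h.isYExtended_base.of_mem_minimalPrimes hP) hIP)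
  have hht := h.height_right_eq hN_cm hN_hom hI_unm hC_unm hC hNI hNC
  exact {
    homogeneous_left := hI_hom
    saturated_left := hI_sat
    unmixed_left := hI_unm
    homogeneous_right := hC_hom
    saturated_right := by
      by_contra hsat
      refine GVD.height_ne_height_irrelevantIdeal hI_hom hI_sat (h.left_ne_top hC) ?_
      rw [hht, hC_unm.height_eq (GVD.irrelevantIdeal_mem_associatedPrimes hsat)]
    unmixed_right := hC_unm
    height_eq := hht
    exists_iso := ⟨GVD.nIdeal j G, le_inf h.le_left h.le_right, hN_hom, hN_cm, hN_g0,
      h.height_left_eq hN_cm hN_hom hI_unm hC hNC,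
      h.gradedIso (hN_cm.isColonTrivial hNI) (hN_cm.isColonTrivial hNC) hI_hom hC_hom hN_hom⟩ }
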